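/- **Setting.** Let $(\Omega,\mathcal F,(\mathcal F_t)_{t\in\mathbb R},\mathbb P)$ be a filtered probability space and let $W$ be an $(\mathcal F_t)$-adapted Gaussian white noise on $\mathbb R$: a centred Gaussian family $(W(A))$ indexed by the Borel sets $A\subset\mathbb R$ of finite Lebesgue measure $|A|$, with $\mathbb E[W(A)W(B)]=|A\cap B|$, such that $W(A)$ is $\mathcal F_t$-measurable if $A\subset(-\infty,t]$ and independent of $\mathcal F_t$ if $A\subset[t,\infty)$. Let $g:(0,\infty)\to\mathbb R$ be in $L^2((0,\infty))$, let $\sigma=(\sigma_t)_{t\in\mathbb R}$ be $(\mathcal F_t)$-adapted with càdlàg paths, assume $\int_{-\infty}^t g^2(t-s)\sigma_s^2\,ds<\infty$ a.s. for every $t\in\mathbb R$, and put $$X_t=\int_{-\infty}^t g(t-s)\sigma_s\,W(ds),\qquad G_t=\int_{-\infty}^t g(t-s)\,W(ds),\qquad t\in\mathbb R .$$ Let $R(t)=\mathbb E[(G_{t+s}-G_s)^2]$, $t\ge 0$ (this does not depend on $s$). For integers $k,v\ge 1$, $p>0$, $\delta>0$, and a process $Y$, put $$\Delta_{i,k}^{v}Y=\sum_{j=0}^k(-1)^j\binom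 kj Y_{(i-vj)\delta},\qquad \tau_k(v\delta)=\sqrt{\mathbb E[|\Delta_{i,k}^{v}G|^2]},\qquad \bar V(Y,p,k,v;\delta)_t=\delta\,\tau_k(v\delta)^{-p}\sum_{i=vk}^{[t/\delta]}|\Delta_{i,k}^{v}Y|^p .$$ A function $L:(0,\infty)\to\mathbb R$ is called slowly varying at $0$ if it is continuous and $\lim_{x\downarrow0}L(tx)/L(x)=1$ for all $t>0$. **Assumptions.** Let $\alpha\in(-\frac12,0)\cup(0,\frac12)$ and let $k\ge1$ be an integer. (A1) $g$ is $k$ times continuously differentiable on $(0,\infty)$; $g(x)=x^\alpha L_g(x)$ and $g^{(k)}(x)=x^{\alpha-k}L_{g^{(k)}}(x)$ for $x>0$ with $L_g$, $L_{g^{(k)}}$ slowly varying at $0$; $g^{(k)}\in L^2((\varepsilon,\infty))$ for every $\varepsilon>0$; $|g^{(k)}|$ is non-increasing on $(a,\infty)$ for some $a>0$; and for every $t>0$, $\int_1^\infty|g^{(k)}(s)|^2\sigma_{t-s}^2\,ds<\infty$ a.s. (A2) $R$ is $2k$ times continuously differentiable on $(0,\infty)$; $R(x)=x^{2\alpha+1}L_R(x)$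 and $R^{(2k)}(x)=x^{2\alpha-2k+1}L_{R^{(2k)}}(x)$ for $x>0$ with $L_R$, $L_{R^{(2k)}}$ slowly varying at $0$; and there is $b\in(0,1)$ with $\limsup_{x\downarrow0}\sup_{y\in[x,x^b]}\big|L_{R^{(2k)}}(y)/L_R(x)\big|<\infty$. **Claim.** Under (A1) and (A2) there is a function $L:(0,\infty)\to\mathbb R$, slowly varying at $0$, such that the following holds for all $T>0$, all real $m\ge1$, all $p>0$, all sequences $\Delta_n>0$ with $\Delta_n\to0$, and all stochastic processes $A=(A_t)_{t\in[0,T]}$ with paths in $C^m([0,T])$ (i.e. $[m]$ times continuously differentiable with $[m]$-th derivative Hölder continuous of order $m-[m]$). Put $Z_t=X_t+A_t$. Then, for every $t\in[0,T]$, $$\big|\bar V(Z,p,k,1;\Delta_n)_t-\bar V(X,p,k,1;\Delta_n)_t\big|=O_{\mathbb P}\Big(\big|\Delta_n^{k\wedge m-\alpha-1/2}L(\Delta_n)\big|^{p\wedge1}\Big)\qquad(n\to\infty),$$ and the rate $\big|\Delta_n^{k\wedge m-\alpha-1/2}L(\Delta_n)\big|^{p\wedge1}$ converges to $0$. -/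

import Mathlib

open MeasureTheory ProbabilityTheory Filter Topology Set
open scoped NNReal ENNReal

noncomputable section

namespace BSS

/-- A real function on `(0, ∞)` that is continuous there and slowly varying at `0`.
Values outside `(0, ∞)` play no role. -/
structure SlowlyVaryingAtZero (L : ℝ → ℝ) : Prop where
  continuousOn : ContinuousOn L (Ioi 0)
  tendsto_ratio : ∀ t : ℝ, 0 < t → Tendsto (fun x => L (t * x) / L x) (𝓝[>] 0) (𝓝 1)

/-- Right-continuous with left limits. -/
def IsCadlagFun (f : ℝ → ℝ) : Prop :=
  ∀ t : ℝ, ContinuousWithinAt f (Ici t) t ∧ ∃ l : ℝ, Tendsto f (𝓝[<] t) (𝓝 l)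

/-- The class `C^m([0,T])` for a real `m ≥ 0`: `⌊m⌋` times continuously differentiable on `[0,T]`,
the derivative of order `⌊m⌋` being Hölder continuous of order `m - ⌊m⌋`. -/
def IsCm (m T : ℝ) (f : ℝ → ℝ) : Prop :=
  ContDiffOn ℝ ⌊m⌋₊ f (Icc 0 T) ∧
    ∃ C : ℝ≥0, HolderOnWith C (m - ⌊m⌋₊).toNNReal
      (iteratedDerivWithin ⌊m⌋₊ f (Icc 0 T)) (Icc 0 T)

section Integral

variable {Ω : Type*} {mΩ : MeasurableSpace Ω}

/-- An `𝓕`-adapted Gaussian white noise on `ℝ`, i.e. a centred Gaussian family indexed by the Borel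
sets of finite Lebesgue measure, with covariance `E[W(A) W(B)] = |A ∩ B|`; `W(A)` is
`𝓕 t`-measurable for `A ⊆ (-∞, t]` and independent of `𝓕 t` for `A ⊆ [t, ∞)`. The values of `W`
on other sets play no role. -/
structure IsWhiteNoise (𝓕 : Filtration ℝ mΩ) (P : Measure Ω) (W : Set ℝ → Ω → ℝ) : Prop where
  gaussian : IsGaussianProcess
    (fun A : {A : Set ℝ // MeasurableSet A ∧ volume A < ∞} => W A.1) P
  mean_zero : ∀ A : Set ℝ, MeasurableSet A → volume A < ∞ → ∫ ω, W A ω ∂P = 0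
  covariance : ∀ A B : Set ℝ, MeasurableSet A → volume A < ∞ → MeasurableSet B → volume B < ∞ →
    ∫ ω, W A ω * W B ω ∂P = (volume (A ∩ B)).toReal
  adapted : ∀ (t : ℝ) (A : Set ℝ), MeasurableSet A → volume A < ∞ → A ⊆ Iic t →
    Measurable[𝓕 t] (W A)
  indep : ∀ (t : ℝ) (A : Set ℝ), MeasurableSet A → volume A < ∞ → A ⊆ Ici t →
    Indep (MeasurableSpace.comap (W A) inferInstance) (𝓕 t) P

/-- A bounded simple adapted integrand `∑_{i < N} ξ_i 1_{(t_i, t_{i+1}]}`, with `t_i` nondecreasing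
and `ξ_i` being `𝓕 (t_i)`-measurable. -/
structure SimpleIntegrand (𝓕 : Filtration ℝ mΩ) where
  N : ℕ
  time : ℕ → ℝ
  mono : Monotone time
  ξ : ℕ → Ω → ℝ
  measurable_ξ : ∀ i, Measurable[𝓕 (time i)] (ξ i)
  bounded_ξ : ∃ C : ℝ, ∀ i ω, |ξ i ω| ≤ C

/-- The value at time `s`. -/
def SimpleIntegrand.eval {𝓕 : Filtration ℝ mΩ} (S : SimpleIntegrand 𝓕) (s : ℝ) (ω : Ω) : ℝ :=
  ∑ i ∈ Finset.range S.N, (Ioc (S.time i) (S.time (i + 1))).indicator (fun _ => S.ξ i ω) s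

/-- The integral `∑_{i < N} ξ_i W((t_i, t_{i+1}])`. -/
def SimpleIntegrand.integral {𝓕 : Filtration ℝ mΩ} (S : SimpleIntegrand 𝓕) (W : Set ℝ → Ω → ℝ)
    (ω : Ω) : ℝ :=
  ∑ i ∈ Finset.range S.N, S.ξ i ω * W (Ioc (S.time i) (S.time (i + 1))) ω

/-- `Y` is (a version of) the Itô integral `∫_ℝ H_s W(ds)`: there are simple integrands `S n` with
`∫ (S n - H)² ds → 0` in probability and `∫ S n dW → Y` in probability. -/
def IsItoIntegral (𝓕 : Filtration ℝ mΩ) (P : Measure Ω) (W : Set ℝ → Ω → ℝ) (H : ℝ → Ω → ℝ)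
    (Y : Ω → ℝ) : Prop :=
  ∃ S : ℕ → SimpleIntegrand 𝓕,
    (∀ ε : ℝ≥0∞, 0 < ε →
      Tendsto (fun n => P {ω | ε ≤ ∫⁻ s, ENNReal.ofReal (((S n).eval s ω - H s ω) ^ 2)})
        atTop (𝓝 0)) ∧
    TendstoInMeasure P (fun n => (S n).integral W) atTop Y

/-- `X_t = ∫_{-∞}^t g(t-s) σ_s W(ds)` for every `t ∈ ℝ` (almost surely for each `t`). -/
def IsMovingAverage (𝓕 : Filtration ℝ mΩ) (P : Measure Ω) (W : Set ℝ → Ω → ℝ) (g : ℝ → ℝ)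
    (σ : ℝ → Ω → ℝ) (X : ℝ → Ω → ℝ) : Prop :=
  ∀ t : ℝ, IsItoIntegral 𝓕 P W (fun s ω => (Iio t).indicator (fun s => g (t - s) * σ s ω) s) (X t)

/-- The Gaussian core `G_t = ∫_{-∞}^t g(t-s) W(ds)`. -/
def IsGaussianCore (𝓕 : Filtration ℝ mΩ) (P : Measure Ω) (W : Set ℝ → Ω → ℝ) (g : ℝ → ℝ)
    (G : ℝ → Ω → ℝ) : Prop :=
  IsMovingAverage 𝓕 P W g (fun _ _ => 1) G

/-- The variogram `R(t) = E[(G_t - G_0)²]` of a process with stationary increments. -/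
def variogram (P : Measure Ω) (G : ℝ → Ω → ℝ) (t : ℝ) : ℝ :=
  ∫ ω, (G t ω - G 0 ω) ^ 2 ∂P

/-- The `k`-th order difference `∑_{j=0}^k (-1)^j (k choose j) Y_{(i - v j) δ}`. -/
def difference (Y : ℝ → Ω → ℝ) (k v : ℕ) (δ : ℝ) (i : ℕ) (ω : Ω) : ℝ :=
  ∑ j ∈ Finset.range (k + 1),
    (-1 : ℝ) ^ j * (k.choose j : ℝ) * Y (((i : ℝ) - (v : ℝ) * (j : ℝ)) * δ) ω

/-- `τ_k(h)`: the `L²` norm of a `k`-th order difference of `G` with time step `h` (taken at stage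
`i = k`; the value does not depend on the stage when `G` is stationary). -/
def tau (P : Measure Ω) (G : ℝ → Ω → ℝ) (k : ℕ) (h : ℝ) : ℝ :=
  √(∫ ω, (difference G k 1 h k ω) ^ 2 ∂P)

/-- `V(Y,p,k,v;δ)_t = ∑_{i=vk}^{[t/δ]} |Δ_{i,k}^v Y|^p`. -/
def powerVariation (Y : ℝ → Ω → ℝ) (p : ℝ) (k v : ℕ) (δ t : ℝ) (ω : Ω) : ℝ :=
  ∑ i ∈ Finset.Icc (v * k) ⌊t / δ⌋₊, |difference Y k v δ i ω| ^ p

/-- `δ τ_k(vδ)^{-p} V(Y,p,k,v;δ)_t`, where `τ_k` is computed from `G`. -/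
def normalizedPowerVariation (P : Measure Ω) (G Y : ℝ → Ω → ℝ) (p : ℝ) (k v : ℕ) (δ t : ℝ)
    (ω : Ω) : ℝ :=
  δ * tau P G k ((v : ℝ) * δ) ^ (-p) * powerVariation Y p k v δ t ω

/-- `Y n = O_P(a n)` as `n → ∞`, for deterministic `a n ≥ 0`. -/
def IsBigOP (P : Measure Ω) (Y : ℕ → Ω → ℝ) (a : ℕ → ℝ) : Prop :=
  ∀ ε : ℝ, 0 < ε → ∃ M : ℝ, 0 < M ∧
    ∀ᶠ n in atTop, P {ω | M * a n < |Y n ω|} ≤ ENNReal.ofReal ε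

/-- Conditions on the weight function `g` for differences of order `k`. -/
structure AssumptionA1 (P : Measure Ω) (g : ℝ → ℝ) (σ : ℝ → Ω → ℝ) (α : ℝ) (k : ℕ) : Prop where
  regular : ∃ L : ℝ → ℝ, SlowlyVaryingAtZero L ∧ ∀ x : ℝ, 0 < x → g x = x ^ α * L x
  contDiffOn : ContDiffOn ℝ k g (Ioi 0)
  regular_deriv : ∃ L : ℝ → ℝ, SlowlyVaryingAtZero L ∧
    ∀ x : ℝ, 0 < x → iteratedDeriv k g x = x ^ (α - k) * L x
  memLp_deriv : ∀ ε : ℝ, 0 < ε → MemLp (iteratedDeriv k g) 2 (volume.restrict (Ioi ε))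
  antitone_deriv : ∃ a : ℝ, 0 < a ∧ AntitoneOn (fun x => |iteratedDeriv k g x|) (Ioi a)
  finite_F : ∀ t : ℝ, 0 < t → ∀ᵐ ω ∂P,
    ∫⁻ s in Ioi (1 : ℝ), ENNReal.ofReal (iteratedDeriv k g s ^ 2 * σ (t - s) ω ^ 2) < ∞

/-- Conditions on the variogram `R` for differences of order `k`. The last clause says that the
limit superior, as `x ↓ 0`, of `sup_{y ∈ [x, x^b]} |L₂(y) / L₁(x)|` is finite. -/
def AssumptionA2 (R : ℝ → ℝ) (α : ℝ) (k : ℕ) : Prop :=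
  ContDiffOn ℝ (2 * k : ℕ) R (Ioi 0) ∧
  ∃ L₁ L₂ : ℝ → ℝ, SlowlyVaryingAtZero L₁ ∧ SlowlyVaryingAtZero L₂ ∧
    (∀ x : ℝ, 0 < x → R x = x ^ (2 * α + 1) * L₁ x) ∧
    (∀ x : ℝ, 0 < x → iteratedDeriv (2 * k) R x = x ^ (2 * α - 2 * k + 1) * L₂ x) ∧
    ∃ b : ℝ, 0 < b ∧ b < 1 ∧ ∃ C : ℝ, ∀ᶠ x in 𝓝[>] (0 : ℝ),
      ∀ y ∈ Icc x (x ^ b), |L₂ y / L₁ x| ≤ C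

end Integral

end BSS

end

namespace BSS

/-! ### Iterated differences -/

/-! Everything reduces to comparing the k-th differences of A with the normalisation τ = `tau P G k
δ`. Paths in C^m have k-th differences of order δ^(k∧m) (`IsCm.exists_abs_fwdDiff_iter_le`). A k-th
difference of G integrates a deterministic kernel that coincides with g on its most recent stretch
of length δ, so τ² dominates a multiple of ∫_0^δ g², which is at least of order δ^(2α+1) L_g(δ)²
(`exists_le_tau`). The ratio is therefore eventually at most a constant times r = δ^(k∧m-α-1/2) /
|L_g(δ)|. Hence L is the reciprocal of |L_g| near 0, and r → 0 because k∧m ≥ 1 > α + 1/2 and powers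
beat slowly varying functions.

For p ≤ 1, subadditivity of |x|^p finishes the proof. For p > 1, the bound ||x+y|^p - |x|^p| ≤
C(|y||x|^(p-1) + |y|^p) leaves a cross term of size r times the normalised variation of X of order p
- 1, so that variation has to be tight (`isBigOP_normalizedPowerVariation`).

For tightness, differences of X are Itô integrals. On an event of large probability σ is bounded on
a compact interval and the remote past contributes quadratic variation of order δ^(2k), so the total
is at most (3Mτ)². The Itô integral is only a limit in probability, so its moments come from
exponential martingales of simple integrands and Fatou's lemma (`setLIntegral_exp_le`,
`setLIntegral_rpow_le`). The same bounds carry half of the isometry over to G, up to a factor 4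
(`lintegral_sq_integrand_le`). -/

theorem exists_fwdDiff_iter_eq {a δ : ℝ} (hδ : 0 < δ) (r : ℕ) :
    ∀ (F : ℕ → ℝ → ℝ) (b : ℝ)
      (_ : ∀ j < r, ∀ y ∈ Icc a b, HasDerivWithinAt (F j) (F (j + 1) y) (Icc a b) y)
      (x : ℝ) (_ : a ≤ x) (_ : x + r * δ ≤ b),
      ∃ ξ ∈ Icc x (x + r * δ), (fwdDiff δ)^[r] (F 0) x = δ ^ r * F r ξ := by
  induction r with
  | zero =>
    intro F b _ x _ _
    exact ⟨x, by simp, by simp⟩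
  | succ r ih =>
    intro F b hF x hax hxb
    push_cast at hxb
    -- One difference is absorbed into the family: the `fwdDiff δ (F j)` again form a chain of
    -- derivatives, on an interval shorter by δ. The last factor δ then comes from an ordinary mean
    -- value step on `F r`.
    obtain ⟨ξ, ⟨hξ1, hξ2⟩, hξ⟩ := ih (fun j => fwdDiff δ (F j)) (b - δ) (by
      intro j hj y hy
      have h1 := hF j (by omega) (y + δ) ⟨by linarith [hy.1], by linarith [hy.2]⟩
      have h2 := hF j (by omega) y ⟨hy.1, by linarith [hy.2]⟩
      have h3 : HasDerivWithinAt (fun z => F j (z + δ)) (F (j + 1) (y + δ)) (Icc a (b - δ)) y := by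
        have := h1.comp (h := fun z => z + δ) (h' := 1) (s := Icc a (b - δ)) y
          ((hasDerivWithinAt_id y _).add_const δ)
          (fun z hz => ⟨by linarith [hz.1], by linarith [hz.2]⟩)
        simpa [Function.comp_def] using this
      exact h3.sub (h2.mono (Icc_subset_Icc le_rfl (by linarith)))) x hax (by linarith)
    have hmv : ∃ η ∈ Ioo ξ (ξ + δ), F (r + 1) η = (F r (ξ + δ) - F r ξ) / (ξ + δ - ξ) := by
      have hr : (0 : ℝ) ≤ r * δ := by positivity
      apply exists_hasDerivAt_eq_slope (F r) (F (r + 1)) (by linarith)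
      · intro y hy
        exact ((hF r (by omega) y ⟨by linarith [hy.1], by linarith [hy.2]⟩).continuousWithinAt).mono
          (Icc_subset_Icc (by linarith) (by linarith))
      · intro y hy
        exact (hF r (by omega) y ⟨by linarith [hy.1], by linarith [hy.2]⟩).hasDerivAt
          (Icc_mem_nhds (by linarith [hy.1]) (by linarith [hy.2]))
    obtain ⟨η, ⟨hη1, hη2⟩, hη⟩ := hmv
    refine ⟨η, ⟨by linarith, by push_cast; linarith⟩, ?_⟩
    rw [Function.iterate_succ_apply, hξ, hη, fwdDiff, add_sub_cancel_left]
    rw [pow_succ]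
    field_simp

theorem fwdDiff_iter_eq_sum (f : ℝ → ℝ) (k : ℕ) (δ x : ℝ) :
    (fwdDiff δ)^[k] f x =
      ∑ j ∈ Finset.range (k + 1), (-1 : ℝ) ^ j * (k.choose j : ℝ) * f (x + ((k : ℝ) - j) * δ) := by
  rw [fwdDiff_iter_eq_sum_shift, ← Finset.sum_range_reflect]
  refine Finset.sum_congr rfl fun j hj => ?_
  have hj' : j ≤ k := by simpa [Nat.lt_succ_iff] using hj
  have h1 : k + 1 - 1 - j = k - j := by omega
  rw [h1, Nat.sub_sub_self hj', Nat.choose_symm hj']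
  simp [Nat.cast_sub hj']

theorem sum_choose_eq_fwdDiff_iter (f : ℝ → ℝ) (k i : ℕ) (δ s : ℝ) :
    ∑ j ∈ Finset.range (k + 1), (-1 : ℝ) ^ j * (k.choose j : ℝ) * f (((i : ℝ) - j) * δ + s) =
      (fwdDiff δ)^[k] f (((i : ℝ) - k) * δ + s) := by
  rw [fwdDiff_iter_eq_sum]
  refine Finset.sum_congr rfl fun j _ => ?_
  congr 2
  ring

theorem difference_one_eq {Ω : Type*} (Y : ℝ → Ω → ℝ) (k i : ℕ) (δ : ℝ) (ω : Ω) :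
    difference Y k 1 δ i ω =
      ∑ j ∈ Finset.range (k + 1),
        (-1 : ℝ) ^ j * (k.choose j : ℝ) * Y (((i : ℝ) - j) * δ) ω := by
  simp [difference]

theorem abs_fwdDiff_iter_le (f : ℝ → ℝ) (δ : ℝ) (B : ℝ) (n : ℕ) :
    ∀ (x : ℝ), (∀ j : ℕ, j ≤ n → |f (x + j * δ)| ≤ B) →
    |(fwdDiff δ)^[n] f x| ≤ 2 ^ n * B := by
  induction n generalizing f B with
  | zero => intro x h; simpa using h 0 le_rfl
  | succ n ih =>
    intro x h
    rw [Function.iterate_succ_apply]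
    refine (ih (fwdDiff δ f) (2 * B) x fun j hj => ?_).trans (le_of_eq (by ring))
    have h1 := h j (by omega)
    have h2 := h (j + 1) (by omega)
    rw [fwdDiff]
    have h3 : x + j * δ + δ = x + ((j + 1 : ℕ) : ℝ) * δ := by push_cast; ring
    rw [h3]
    rw [abs_le] at h1 h2 ⊢
    constructor <;> linarith [h1.1, h1.2, h2.1, h2.2]

theorem hasDerivWithinAt_iteratedDerivWithin {f : ℝ → ℝ} {T : ℝ} (hT : 0 < T) {n : ℕ}
    (hf : ContDiffOn ℝ n f (Icc 0 T)) {j : ℕ} (hj : j < n) {y : ℝ} (hy : y ∈ Icc 0 T) :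
    HasDerivWithinAt (iteratedDerivWithin j f (Icc 0 T))
      (iteratedDerivWithin (j + 1) f (Icc 0 T) y) (Icc 0 T) y := by
  rw [iteratedDerivWithin_succ]
  exact ((hf.differentiableOn_iteratedDerivWithin (by exact_mod_cast hj)
    (uniqueDiffOn_Icc hT)) y hy).hasDerivWithinAt

/-- Differences of order `k` of a function in `C^m` are of order `δ ^ (k ∧ m)`. -/
theorem IsCm.exists_abs_fwdDiff_iter_le {m T : ℝ} (hT : 0 < T) (hm : 1 ≤ m) {f : ℝ → ℝ}
    (hf : IsCm m T f) (k : ℕ) :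
    ∃ C : ℝ, ∀ δ x : ℝ, 0 < δ → 0 ≤ x → x + k * δ ≤ T →
      |(fwdDiff δ)^[k] f x| ≤ C * δ ^ min (k : ℝ) m := by
  obtain ⟨hcd, C, hC⟩ := hf
  set r := ⌊m⌋₊ with hr
  have hrm : (r : ℝ) ≤ m := Nat.floor_le (by linarith)
  rcases le_or_gt k r with hkr | hkr
  · have hkm : (k : ℝ) ≤ m := le_trans (by exact_mod_cast hkr) hrm
    have hcont : ContinuousOn (iteratedDerivWithin k f (Icc 0 T)) (Icc 0 T) :=
      hcd.continuousOn_iteratedDerivWithin (by exact_mod_cast hkr) (uniqueDiffOn_Icc hT)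
    obtain ⟨B, hB⟩ := isCompact_Icc.exists_bound_of_continuousOn hcont
    refine ⟨B, fun δ x hδ hx hxT => ?_⟩
    obtain ⟨ξ, hξ, h⟩ := exists_fwdDiff_iter_eq (a := 0) hδ k
      (fun j => iteratedDerivWithin j f (Icc 0 T)) T
      (fun j hj y hy => hasDerivWithinAt_iteratedDerivWithin hT hcd (by omega) hy) x hx hxT
    simp only [iteratedDerivWithin_zero] at h
    rw [min_eq_left hkm, Real.rpow_natCast, h, abs_mul, abs_of_pos (pow_pos hδ k), mul_comm]
    have := hB ξ ⟨hx.trans hξ.1, hξ.2.trans hxT⟩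
    rw [Real.norm_eq_abs] at this
    gcongr
  · have hmk : m ≤ k := by
      have : m < r + 1 := Nat.lt_floor_add_one m
      have h2 : ((r + 1 : ℕ) : ℝ) ≤ k := by exact_mod_cast hkr
      push_cast at h2; linarith
    -- Of the k differences, r are traded for derivatives, one uses the Hölder bound, and the
    -- remaining l cost only the factor `2 ^ l`.
    obtain ⟨l, rfl⟩ : ∃ l, k = (l + 1) + r := ⟨k - r - 1, by omega⟩
    refine ⟨2 ^ l * C, fun δ x hδ hx hxT => ?_⟩
    push_cast at hxT
    have hlδ : (0 : ℝ) ≤ l * δ := by positivity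
    have hrδ : (0 : ℝ) ≤ r * δ := by positivity
    set b := T - (l + 1) * δ with hb
    have hder : ∀ n : ℕ, ∀ j < r, ∀ y ∈ Icc 0 (T - n * δ), HasDerivWithinAt
        ((fwdDiff δ)^[n] (iteratedDerivWithin j f (Icc 0 T)))
        ((fwdDiff δ)^[n] (iteratedDerivWithin (j + 1) f (Icc 0 T)) y) (Icc 0 (T - n * δ)) y := by
      intro n j hj
      induction n with
      | zero =>
        intro y hy
        simpa using hasDerivWithinAt_iteratedDerivWithin hT hcd hj (by simpa using hy)
      | succ n ih =>
        intro y hy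
        push_cast at hy ⊢
        have e : T - (n + 1) * δ = T - n * δ - δ := by ring
        rw [e] at hy ⊢
        rw [Function.iterate_succ_apply', Function.iterate_succ_apply']
        have h2 := ih y ⟨hy.1, by linarith [hy.2]⟩
        have h1 := (ih (y + δ) ⟨by linarith [hy.1], by linarith [hy.2]⟩).comp
          (h := fun z => z + δ) (h' := 1) (s := Icc 0 (T - n * δ - δ)) y
          ((hasDerivWithinAt_id y _).add_const δ)
          (fun z hz => ⟨by linarith [hz.1], by linarith [hz.2]⟩)
        rw [mul_one] at h1
        exact h1.sub (h2.mono (Icc_subset_Icc le_rfl (by linarith)))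
    obtain ⟨ξ, hξ, h⟩ := exists_fwdDiff_iter_eq (a := 0) hδ r
      (fun j => (fwdDiff δ)^[l + 1] (iteratedDerivWithin j f (Icc 0 T))) b
      (by simpa [hb] using hder (l + 1)) x hx (by rw [hb]; linarith)
    simp only [iteratedDerivWithin_zero] at h
    rw [← Function.iterate_add_apply, add_comm r] at h
    rw [h, abs_mul, abs_of_pos (pow_pos hδ r), Function.iterate_succ_apply,
      min_eq_right hmk]
    have hhol : ∀ y, 0 ≤ y → y + δ ≤ T →
        |fwdDiff δ (iteratedDerivWithin r f (Icc 0 T)) y| ≤ C * δ ^ (m - r) := by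
      intro y hy hyT
      have := hC.dist_le (x := y + δ) (y := y) ⟨by linarith, hyT⟩ ⟨hy, by linarith⟩
      rw [Real.dist_eq, Real.dist_eq, add_sub_cancel_left, abs_of_pos hδ,
        Real.coe_toNNReal _ (by linarith)] at this
      exact this
    have h3 := abs_fwdDiff_iter_le (fwdDiff δ (iteratedDerivWithin r f (Icc 0 T))) δ
      (C * δ ^ (m - r)) l ξ (fun j hj => hhol _ (by
        have : (0:ℝ) ≤ j * δ := by positivity
        linarith [hξ.1]) (by
        have hjl : (j : ℝ) * δ ≤ l * δ := by gcongr
        linarith [hξ.2]))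
    calc δ ^ r * _ ≤ δ ^ r * (2 ^ l * (C * δ ^ (m - r))) := by gcongr
      _ = 2 ^ l * C * (δ ^ (r : ℝ) * δ ^ (m - r)) := by rw [Real.rpow_natCast]; ring
      _ = _ := by rw [← Real.rpow_add hδ]; congr 2; ring

/-! ### Slow variation -/

/-- Baire category: the closed sets of shifts that move h by at most 1 beyond n cover the line, so
one of them contains an interval starting at some s₀. Undoing the shift by s₀ brings that interval
to 0, at the price 1 + 1 = 2. For h(u) = log L(exp(-u)) this is a weak uniform convergence theorem
for slowly varying functions. -/
theorem exists_forall_abs_shift_sub_le {h : ℝ → ℝ} (hc : Continuous h)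
    (hs : ∀ s, Tendsto (fun u => h (u + s) - h u) atTop (𝓝 0)) :
    ∃ d > 0, ∃ U : ℝ, ∀ u ≥ U, ∀ s ∈ Icc 0 d, |h (u + s) - h u| ≤ 2 := by
  let E : ℕ → Set ℝ := fun n => {s | ∀ u : ℝ, (n : ℝ) ≤ u → |h (u + s) - h u| ≤ 1}
  have hE : ∀ n, IsClosed (E n) := by
    intro n
    have : E n = ⋂ (u : ℝ) (_ : (n : ℝ) ≤ u), {s | |h (u + s) - h u| ≤ 1} := by
      ext s; simp [E]
    rw [this]
    exact isClosed_iInter fun u => isClosed_iInter fun _ =>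
      isClosed_le (by fun_prop) continuous_const
  have hU : ⋃ n, E n = univ := by
    refine eq_univ_of_forall fun s => ?_
    have h1 : ∀ᶠ u in atTop, |h (u + s) - h u| ≤ 1 := by
      have := (hs s).abs
      rw [abs_zero] at this
      exact this.eventually (eventually_le_nhds one_pos)
    obtain ⟨a, ha⟩ := eventually_atTop.1 h1
    obtain ⟨n, hn⟩ := exists_nat_ge a
    exact mem_iUnion.2 ⟨n, fun u hu => ha u (hn.trans hu)⟩
  obtain ⟨n, s₀, hs₀⟩ := nonempty_interior_of_iUnion_of_closed hE hU
  obtain ⟨r, hr, hball⟩ := Metric.isOpen_iff.1 isOpen_interior s₀ hs₀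
  refine ⟨r / 2, by positivity, n + s₀, fun u hu s hs => ?_⟩
  have h1 : s₀ ∈ E n := interior_subset hs₀
  have h2 : s₀ + s ∈ E n := interior_subset (hball (by
    rw [Metric.mem_ball, Real.dist_eq, add_sub_cancel_left, abs_of_nonneg hs.1]
    linarith [hs.2]))
  have h3 := h1 (u - s₀) (by linarith)
  have h4 := h2 (u - s₀) (by linarith)
  rw [sub_add_cancel] at h3
  rw [← add_assoc, sub_add_cancel] at h4
  rw [abs_le] at h3 h4 ⊢
  constructor <;> linarith [h3.1, h3.2, h4.1, h4.2]

/-- Far out, h gains at most ε d over a step of length d, and it moves by at most 2 within a step.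
-/
theorem exists_forall_le_add_mul {h : ℝ → ℝ} (hc : Continuous h)
    (hs : ∀ s, Tendsto (fun u => h (u + s) - h u) atTop (𝓝 0)) {ε : ℝ} (hε : 0 < ε) :
    ∃ C U : ℝ, ∀ u ≥ U, h u ≤ C + ε * u := by
  obtain ⟨d, hd, U₁, hU₁⟩ := exists_forall_abs_shift_sub_le hc hs
  have h1 : ∀ᶠ u in atTop, h (u + d) - h u ≤ ε * d :=
    (hs d).eventually (eventually_le_nhds (by positivity))
  obtain ⟨U₂, hU₂⟩ := eventually_atTop.1 h1
  set U := max U₁ U₂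
  have hn : ∀ n : ℕ, ∀ u ≥ U, h (u + n * d) ≤ h u + n * (ε * d) := by
    intro n
    induction n with
    | zero => intro u _; simp
    | succ n ih =>
      intro u hu
      have hnd : (0 : ℝ) ≤ n * d := by positivity
      have h2 := hU₂ (u + n * d) (by linarith [le_max_right U₁ U₂])
      have h3 := ih u hu
      have h4 : u + ((n + 1 : ℕ) : ℝ) * d = u + n * d + d := by push_cast; ring
      rw [h4]
      push_cast
      linarith
  refine ⟨h U + 2 - ε * U, U, fun u hu => ?_⟩
  have hq : 0 ≤ (u - U) / d := div_nonneg (by linarith) hd.le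
  set n := ⌊(u - U) / d⌋₊
  have hn1 : (n : ℝ) * d ≤ u - U := by
    rw [← le_div_iff₀ hd]; exact Nat.floor_le hq
  have hn2 : u - U < (n + 1) * d := by
    rw [← div_lt_iff₀ hd]; exact Nat.lt_floor_add_one _
  have h5 := hn n (u - n * d) (by linarith)
  have h6 := hU₁ U (le_max_left _ _) (u - n * d - U) ⟨by linarith, by linarith⟩
  rw [sub_add_cancel] at h5
  rw [add_sub_cancel, abs_le] at h6
  nlinarith [h6.2, mul_le_mul_of_nonneg_left hn1 hε.le]

theorem SlowlyVaryingAtZero.inv {L : ℝ → ℝ} (hL : SlowlyVaryingAtZero L)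
    (hpos : ∀ x, 0 < x → 0 < L x) : SlowlyVaryingAtZero (fun x => (L x)⁻¹) where
  continuousOn := hL.continuousOn.inv₀ fun x hx => (hpos x hx).ne'
  tendsto_ratio t ht := by
    have := (hL.tendsto_ratio t ht).inv₀ one_ne_zero
    rw [inv_one] at this
    refine this.congr fun x => ?_
    rw [inv_div_inv, inv_div]

/-- A reciprocal will be taken, so zeros must go. There are none near 0, and freezing |L| beyond b
removes those farther out without changing the germ at 0. -/
theorem SlowlyVaryingAtZero.exists_pos {L : ℝ → ℝ} (hL : SlowlyVaryingAtZero L) :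
    ∃ L' : ℝ → ℝ, SlowlyVaryingAtZero L' ∧ (∀ x, 0 < x → 0 < L' x) ∧
      ∀ᶠ x in 𝓝[>] (0 : ℝ), L' x = |L x| := by
  have h1 : ∀ᶠ x in 𝓝[>] (0 : ℝ), L x ≠ 0 := by
    -- Division by zero gives 0, so positivity of the ratio with t = 1 already excludes `L x = 0`.
    filter_upwards [(hL.tendsto_ratio 1 one_pos).eventually (lt_mem_nhds (show (0:ℝ) < 1 by simp))]
      with x hx h0
    simp [h0] at hx
  obtain ⟨x₀, hx₀, hne⟩ := (nhdsGT_basis (0 : ℝ)).eventually_iff.1 h1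
  set b := x₀ / 2
  have hb : 0 < b := by positivity
  have hbx : b < x₀ := half_lt_self hx₀
  have hlt : ∀ᶠ x in 𝓝[>] (0 : ℝ), x < b := nhdsWithin_le_nhds (gt_mem_nhds hb)
  refine ⟨fun x => |L (min x b)|, ⟨?_, fun t ht => ?_⟩, fun x hx => ?_, ?_⟩
  · refine (hL.continuousOn.comp (f := fun x => min x b) (by fun_prop) fun x hx => ?_).abs
    exact lt_min hx hb
  · have h2 := (hL.tendsto_ratio t ht).abs
    rw [abs_one] at h2
    refine h2.congr' ?_
    have hlt' : ∀ᶠ x in 𝓝[>] (0 : ℝ), x < b / t := nhdsWithin_le_nhds (gt_mem_nhds (by positivity))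
    filter_upwards [hlt, hlt'] with x hx hx'
    rw [lt_div_iff₀ ht] at hx'
    simp only [min_eq_left hx.le, min_eq_left (show t * x ≤ b by linarith), abs_div]
  · exact abs_pos.2 (hne ⟨lt_min hx hb, (min_le_right _ _).trans_lt hbx⟩)
  · filter_upwards [hlt] with x hx
    simp only [min_eq_left hx.le]

theorem tendsto_exp_neg_atTop_nhdsGT : Tendsto (fun u : ℝ => Real.exp (-u)) atTop (𝓝[>] 0) :=
  tendsto_nhdsWithin_iff.2 ⟨Real.tendsto_exp_neg_atTop_nhds_zero, .of_forall fun _ => Real.exp_pos _⟩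

namespace SlowlyVaryingAtZero

variable {L : ℝ → ℝ}

theorem continuous_log_comp_exp (hL : SlowlyVaryingAtZero L) (hpos : ∀ x, 0 < x → 0 < L x) :
    Continuous fun u => Real.log (L (Real.exp (-u))) := by
  have : Continuous fun u => L (Real.exp (-u)) :=
    hL.continuousOn.comp_continuous (by fun_prop) fun u => Real.exp_pos _
  exact this.log fun u => (hpos _ (Real.exp_pos _)).ne'

theorem tendsto_log_comp_exp_shift (hL : SlowlyVaryingAtZero L) (hpos : ∀ x, 0 < x → 0 < L x)
    (s : ℝ) : Tendsto (fun u => Real.log (L (Real.exp (-(u + s)))) - Real.log (L (Real.exp (-u))))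
      atTop (𝓝 0) := by
  have h1 := ((hL.tendsto_ratio _ (Real.exp_pos (-s))).comp tendsto_exp_neg_atTop_nhdsGT).log
    one_ne_zero
  rw [Real.log_one] at h1
  refine h1.congr fun u => ?_
  simp only [Function.comp]
  rw [Real.log_div (hpos _ (by positivity)).ne' (hpos _ (Real.exp_pos _)).ne', ← Real.exp_add]
  ring_nf

/-- A slowly varying function is dominated by every negative power near `0`. -/
theorem tendsto_rpow_mul (hL : SlowlyVaryingAtZero L) (hpos : ∀ x, 0 < x → 0 < L x)
    {ε : ℝ} (hε : 0 < ε) : Tendsto (fun x => x ^ ε * L x) (𝓝[>] 0) (𝓝 0) := by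
  -- Half of the exponent pays for L and the other half produces the limit.
  obtain ⟨C, U, h⟩ := exists_forall_le_add_mul (hL.continuous_log_comp_exp hpos)
    (hL.tendsto_log_comp_exp_shift hpos) (half_pos hε)
  have hlim : Tendsto (fun x : ℝ => Real.exp C * x ^ (ε / 2)) (𝓝[>] 0) (𝓝 0) := by
    have h0 : Tendsto (fun x : ℝ => x ^ (ε / 2)) (𝓝[>] 0) (𝓝 0) := by
      have := (Real.continuousAt_rpow_const (0:ℝ) (ε / 2) (Or.inr (by positivity))).tendsto
      rw [Real.zero_rpow (by positivity)] at this
      exact this.mono_left nhdsWithin_le_nhds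
    simpa using h0.const_mul (Real.exp C)
  refine squeeze_zero' ?_ ?_ hlim
  · filter_upwards [self_mem_nhdsWithin] with x hx
    have := hpos x hx
    have hx' : (0:ℝ) < x := hx
    positivity
  · have hlt : ∀ᶠ x in 𝓝[>] (0 : ℝ), x < Real.exp (-U) :=
      nhdsWithin_le_nhds (gt_mem_nhds (Real.exp_pos _))
    filter_upwards [self_mem_nhdsWithin, hlt] with x hx hxU
    have hx' : (0:ℝ) < x := hx
    have h1 := h (-Real.log x) (by
      have := Real.log_lt_log hx' hxU
      rw [Real.log_exp] at this
      change U ≤ _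
      linarith)
    simp only [neg_neg, Real.exp_log hx'] at h1
    have h2 : L x ≤ Real.exp C * x ^ (-(ε / 2)) := by
      rw [← Real.exp_log (hpos x hx), Real.rpow_def_of_pos hx', ← Real.exp_add]
      exact Real.exp_le_exp.2 (by linarith)
    calc x ^ ε * L x ≤ x ^ ε * (Real.exp C * x ^ (-(ε / 2))) := by gcongr
      _ = Real.exp C * (x ^ ε * x ^ (-(ε / 2))) := by ring
      _ = _ := by rw [← Real.rpow_add hx']; ring_nf

/-- Uniformity over a whole block `[q * x, x]` is needed in order to integrate; the limits of ratios
for each fixed t do not give it directly. -/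
theorem exists_forall_le (hL : SlowlyVaryingAtZero L) (hpos : ∀ x, 0 < x → 0 < L x) :
    ∃ q ∈ Ioo (0 : ℝ) 1, ∃ c > 0, ∀ᶠ x in 𝓝[>] (0 : ℝ), ∀ y ∈ Icc (q * x) x, c * L x ≤ L y := by
  obtain ⟨d, hd, U, h⟩ := exists_forall_abs_shift_sub_le (hL.continuous_log_comp_exp hpos)
    (hL.tendsto_log_comp_exp_shift hpos)
  refine ⟨Real.exp (-d), ⟨Real.exp_pos _, Real.exp_lt_one_iff.2 (by linarith)⟩, Real.exp (-2),
    Real.exp_pos _, ?_⟩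
  have hlt : ∀ᶠ x in 𝓝[>] (0 : ℝ), x < Real.exp (-U) :=
    nhdsWithin_le_nhds (gt_mem_nhds (Real.exp_pos _))
  filter_upwards [self_mem_nhdsWithin, hlt] with x hx hxU y hy
  have hx' : (0:ℝ) < x := hx
  have hy' : 0 < y := lt_of_lt_of_le (by positivity) hy.1
  have h1 := h (-Real.log x) (by
    have := Real.log_lt_log hx' hxU
    rw [Real.log_exp] at this
    change U ≤ _
    linarith) (Real.log x - Real.log y) ⟨by
      linarith [Real.log_le_log hy' hy.2], by
      have := Real.log_le_log (by positivity) hy.1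
      rw [Real.log_mul (Real.exp_pos _).ne' hx'.ne', Real.log_exp] at this
      linarith⟩
  have e : -(-Real.log x + (Real.log x - Real.log y)) = Real.log y := by ring
  simp only [e, neg_neg, Real.exp_log hx', Real.exp_log hy'] at h1
  rw [← Real.exp_log (hpos x hx), ← Real.exp_log (hpos y hy'), ← Real.exp_add]
  exact Real.exp_le_exp.2 (by linarith [(abs_le.1 h1).1])

end SlowlyVaryingAtZero

/-- The mass near `0` of the square of a regularly varying function is at least of the order
predicted by Karamata's theorem. -/
theorem exists_le_lintegral_sq {L g : ℝ → ℝ} {α : ℝ} (hL : SlowlyVaryingAtZero L)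
    (hpos : ∀ x, 0 < x → 0 < L x) (hg : ∀ᶠ x in 𝓝[>] (0 : ℝ), |g x| = x ^ α * L x)
    (hα : α < 1 / 2) :
    ∃ c > 0, ∀ᶠ x in 𝓝[>] (0 : ℝ), ENNReal.ofReal (c * (x ^ (α + 1 / 2) * L x) ^ 2) ≤
      ∫⁻ y in Ioc 0 x, ENNReal.ofReal (g y ^ 2) := by
  obtain ⟨q, ⟨hq0, hq1⟩, c, hc, h⟩ := hL.exists_forall_le hpos
  refine ⟨q * c ^ 2 * (1 - q), by have := sub_pos.2 hq1; positivity, ?_⟩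
  obtain ⟨x₀, hx₀, hgx⟩ := (nhdsGT_basis (0 : ℝ)).eventually_iff.1 hg
  have hlt : ∀ᶠ x in 𝓝[>] (0 : ℝ), x < x₀ := nhdsWithin_le_nhds (gt_mem_nhds hx₀)
  filter_upwards [h, self_mem_nhdsWithin, hlt] with x hx hx0 hxx
  have hx0' : (0:ℝ) < x := hx0
  have hLx := hpos x hx0
  have hqx : 0 < q * x := by positivity
  calc ENNReal.ofReal (q * c ^ 2 * (1 - q) * (x ^ (α + 1 / 2) * L x) ^ 2)
      = ENNReal.ofReal (q * (x ^ α * (c * L x)) ^ 2) * volume (Ioc (q * x) x) := by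
        rw [Real.volume_Ioc, ← ENNReal.ofReal_mul (by positivity), Real.rpow_add hx0']
        congr 1
        have : (x ^ (1 / 2 : ℝ)) ^ 2 = x := by
          rw [← Real.rpow_natCast, ← Real.rpow_mul hx0'.le]; norm_num
        calc _ = q * c ^ 2 * (1 - q) * (x ^ α) ^ 2 * (x ^ (1 / 2 : ℝ)) ^ 2 * L x ^ 2 := by ring
          _ = _ := by rw [this]; ring
    _ = ∫⁻ _ in Ioc (q * x) x, ENNReal.ofReal (q * (x ^ α * (c * L x)) ^ 2) := by
        rw [setLIntegral_const]
    _ ≤ ∫⁻ y in Ioc (q * x) x, ENNReal.ofReal (g y ^ 2) := by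
        refine setLIntegral_mono' measurableSet_Ioc fun y hy => ENNReal.ofReal_le_ofReal ?_
        have hy0 : 0 < y := hqx.trans hy.1
        rw [← sq_abs (g y), hgx ⟨hy0, hy.2.trans_lt hxx⟩]
        have hyx : 0 < y / x := by positivity
        -- Since 2α ≤ 1 and y/x ≤ 1, (y/x)^(2α) ≥ y/x ≥ q, whatever the sign of α.
        have h1 : q * (x ^ α) ^ 2 ≤ (y ^ α) ^ 2 := by
          have e : y ^ α = (y / x) ^ α * x ^ α := by
            rw [← Real.mul_rpow hyx.le hx0'.le, div_mul_cancel₀ _ hx0'.ne']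
          rw [e, mul_pow]
          gcongr
          rw [← Real.rpow_natCast, ← Real.rpow_mul hyx.le]
          calc q ≤ (y / x) ^ (1 : ℝ) := by
                rw [Real.rpow_one, le_div_iff₀ hx0']; exact hy.1.le
            _ ≤ _ := Real.rpow_le_rpow_of_exponent_ge hyx ((div_le_one hx0').2 hy.2)
                (by push_cast; linarith)
        have h2 := hx y ⟨hy.1.le, hy.2⟩
        calc q * (x ^ α * (c * L x)) ^ 2 = q * (x ^ α) ^ 2 * (c * L x) ^ 2 := by ring
          _ ≤ (y ^ α) ^ 2 * L y ^ 2 := by gcongr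
          _ = _ := by ring
    _ ≤ _ := lintegral_mono_set (Ioc_subset_Ioc_left hqx.le)

/-! ### Power differences -/

/-- Raise `u ≤ exp u`, at u = |y|/q, to the power q. All moments are thus controlled by two
exponential moments. -/
theorem rpow_abs_le_exp {q : ℝ} (hq : 0 < q) (y : ℝ) :
    |y| ^ q ≤ q ^ q * (Real.exp y + Real.exp (-y)) := by
  have h1 : |y| / q ≤ Real.exp (|y| / q) := by linarith [Real.add_one_le_exp (|y| / q)]
  have h2 : (|y| / q) ^ q ≤ Real.exp |y| := by
    calc (|y| / q) ^ q ≤ Real.exp (|y| / q) ^ q := by gcongr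
      _ = _ := by rw [← Real.exp_mul, div_mul_cancel₀ _ hq.ne']
  rw [Real.div_rpow (abs_nonneg y) hq.le, div_le_iff₀ (by positivity)] at h2
  have h3 : Real.exp |y| ≤ Real.exp y + Real.exp (-y) := by
    rcases abs_choice y with h | h <;> rw [h] <;> linarith [Real.exp_pos y, Real.exp_pos (-y)]
  calc |y| ^ q ≤ Real.exp |y| * q ^ q := h2
    _ ≤ _ := by rw [mul_comm]; gcongr

theorem abs_rpow_abs_add_sub_le_of_le_one {p : ℝ} (hp : 0 < p) (hp1 : p ≤ 1) (x y : ℝ) :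
    |(|x + y| ^ p - |x| ^ p)| ≤ |y| ^ p := by
  have key : ∀ a b : ℝ, |a + b| ^ p ≤ |a| ^ p + |b| ^ p := fun a b =>
    (Real.rpow_le_rpow (abs_nonneg _) (abs_add_le a b) hp.le).trans
      (Real.rpow_add_le_add_rpow (abs_nonneg _) (abs_nonneg _) hp.le hp1)
  have h1 := key x y
  have h2 := key (x + y) (-y)
  rw [add_neg_cancel_right, abs_neg] at h2
  rw [abs_le]
  constructor <;> linarith

/-- The mean value theorem gives a factor at most (|x| + |y|)^(p-1), which is then split. The term
linear in |y| is the reason why the rate has exponent 1 when p > 1. -/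
theorem abs_rpow_abs_add_sub_le_of_one_lt {p : ℝ} (hp1 : 1 < p) :
    ∃ C > 0, ∀ x y : ℝ, |(|x + y| ^ p - |x| ^ p)| ≤ C * (|y| * |x| ^ (p - 1) + |y| ^ p) := by
  have key : ∀ a b : ℝ, 0 ≤ a → 0 ≤ b → b ^ p - a ^ p ≤ p * |b - a| * b ^ (p - 1) := by
    intro a b ha hb
    rcases le_or_gt b a with h | h
    · have := Real.rpow_le_rpow hb h (by linarith : 0 ≤ p)
      have : 0 ≤ p * |b - a| * b ^ (p - 1) := by positivity
      linarith
    · obtain ⟨c, hc, hcd⟩ := exists_hasDerivAt_eq_slope (fun x : ℝ => x ^ p)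
        (fun x => p * x ^ (p - 1)) h
        (fun x _ => (Real.continuousAt_rpow_const x p (Or.inr (by linarith))).continuousWithinAt)
        (fun x _ => Real.hasDerivAt_rpow_const (Or.inr hp1.le))
      rw [eq_div_iff (by linarith)] at hcd
      rw [← hcd, abs_of_pos (by linarith)]
      have : c ^ (p - 1) ≤ b ^ (p - 1) :=
        Real.rpow_le_rpow (ha.trans hc.1.le) hc.2.le (by linarith)
      have hba : 0 ≤ b - a := by linarith
      calc p * c ^ (p - 1) * (b - a) ≤ p * b ^ (p - 1) * (b - a) := by gcongr
        _ = _ := by ring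
  have hmax : ∀ x y : ℝ, (|x| + |y|) ^ (p - 1) ≤ 2 ^ (p - 1) * (|x| ^ (p - 1) + |y| ^ (p - 1)) := by
    intro x y
    calc (|x| + |y|) ^ (p - 1) ≤ (2 * max |x| |y|) ^ (p - 1) := by
          refine Real.rpow_le_rpow (by positivity) ?_ (by linarith)
          linarith [le_max_left |x| |y|, le_max_right |x| |y|]
      _ = 2 ^ (p - 1) * (max |x| |y|) ^ (p - 1) := Real.mul_rpow (by norm_num) (by positivity)
      _ ≤ _ := by
        gcongr
        have h1 : 0 ≤ |x| ^ (p - 1) := by positivity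
        have h2 : 0 ≤ |y| ^ (p - 1) := by positivity
        rcases max_cases |x| |y| with ⟨h, _⟩ | ⟨h, _⟩ <;> rw [h] <;> linarith
  refine ⟨p * 2 ^ (p - 1), by positivity, fun x y => ?_⟩
  have hxy : |(|x + y| - |x|)| ≤ |y| := by
    have := abs_abs_sub_abs_le (x + y) x
    rwa [add_sub_cancel_left] at this
  have hb : ∀ b : ℝ, 0 ≤ b → b ≤ |x| + |y| →
      p * |y| * b ^ (p - 1) ≤ p * 2 ^ (p - 1) * (|y| * |x| ^ (p - 1) + |y| ^ p) := by
    intro b hb hbxy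
    have hyp : |y| * |y| ^ (p - 1) = |y| ^ p := by
      rcases (abs_nonneg y).eq_or_lt with h | h
      · rw [← h, Real.zero_rpow (by positivity : p ≠ 0), zero_mul]
      · rw [← Real.rpow_one_add' h.le (by linarith)]; congr 1; ring
    calc p * |y| * b ^ (p - 1) ≤ p * |y| * (2 ^ (p - 1) * (|x| ^ (p - 1) + |y| ^ (p - 1))) := by
          gcongr
          exact (Real.rpow_le_rpow hb hbxy (by linarith)).trans (hmax x y)
      _ = p * 2 ^ (p - 1) * (|y| * |x| ^ (p - 1) + |y| * |y| ^ (p - 1)) := by ring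
      _ = _ := by rw [hyp]
  rw [abs_le]
  constructor
  · have h1 := key |x + y| |x| (abs_nonneg _) (abs_nonneg _)
    rw [abs_sub_comm] at h1
    have h2 := hb |x| (abs_nonneg _) (by linarith [abs_nonneg y])
    have : p * |(|x + y| - |x|)| * |x| ^ (p - 1) ≤ p * |y| * |x| ^ (p - 1) := by gcongr
    linarith
  · have h1 := key |x| |x + y| (abs_nonneg _) (abs_nonneg _)
    have h2 := hb |x + y| (abs_nonneg _) (abs_add_le _ _)
    have : p * |(|x + y| - |x|)| * |x + y| ^ (p - 1) ≤ p * |y| * |x + y| ^ (p - 1) := by gcongr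
    linarith

variable {Ω : Type*} {mΩ : MeasurableSpace Ω} {P : Measure Ω} {𝓕 : Filtration ℝ mΩ}
  {W : Set ℝ → Ω → ℝ}

/-! ### White noise on intervals -/

theorem volume_Ioc_lt_top (a b : ℝ) : volume (Ioc a b) < ∞ := by simp

theorem integral_quadratic {f₁ f₂ f₃ f₄ f₅ f₆ : Ω → ℝ} (h₁ : Integrable f₁ P)
    (h₂ : Integrable f₂ P) (h₃ : Integrable f₃ P) (h₄ : Integrable f₄ P) (h₅ : Integrable f₅ P)
    (h₆ : Integrable f₆ P) :
    ∫ ω, (f₁ ω + f₂ ω + f₃ ω + 2 * f₄ ω - 2 * f₅ ω - 2 * f₆ ω) ∂P =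
      ∫ ω, f₁ ω ∂P + ∫ ω, f₂ ω ∂P + ∫ ω, f₃ ω ∂P + 2 * ∫ ω, f₄ ω ∂P - 2 * ∫ ω, f₅ ω ∂P -
        2 * ∫ ω, f₆ ω ∂P := by
  have a₁ : Integrable (fun ω => f₁ ω + f₂ ω) P := h₁.add h₂
  have a₂ : Integrable (fun ω => f₁ ω + f₂ ω + f₃ ω) P := a₁.add h₃
  have a₃ : Integrable (fun ω => f₁ ω + f₂ ω + f₃ ω + 2 * f₄ ω) P := a₂.add (h₄.const_mul 2)
  have a₄ : Integrable (fun ω => f₁ ω + f₂ ω + f₃ ω + 2 * f₄ ω - 2 * f₅ ω) P :=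
    a₃.sub (h₅.const_mul 2)
  rw [integral_sub a₄ (h₆.const_mul 2), integral_sub a₃ (h₅.const_mul 2),
    integral_add a₂ (h₄.const_mul 2), integral_add a₁ h₃, integral_add h₁ h₂]
  simp only [integral_const_mul]

namespace IsWhiteNoise

theorem measurable_Ioc (hW : IsWhiteNoise 𝓕 P W) (a b : ℝ) : Measurable (W (Ioc a b)) :=
  (hW.adapted b _ measurableSet_Ioc (volume_Ioc_lt_top a b) Ioc_subset_Iic_self).mono
    (𝓕.le b) le_rfl

theorem hasGaussianLaw_Ioc (hW : IsWhiteNoise 𝓕 P W) (a b : ℝ) :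
    HasGaussianLaw (W (Ioc a b)) P :=
  hW.gaussian.hasGaussianLaw_eval ⟨Ioc a b, measurableSet_Ioc, volume_Ioc_lt_top a b⟩

theorem covariance_Ioc (hW : IsWhiteNoise 𝓕 P W) (a b c d : ℝ) :
    ∫ ω, W (Ioc a b) ω * W (Ioc c d) ω ∂P = (volume (Ioc a b ∩ Ioc c d)).toReal :=
  hW.covariance _ _ measurableSet_Ioc (volume_Ioc_lt_top _ _) measurableSet_Ioc
    (volume_Ioc_lt_top _ _)

theorem integrable_mul_Ioc (hW : IsWhiteNoise 𝓕 P W) (a b c d : ℝ) :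
    Integrable (fun ω => W (Ioc a b) ω * W (Ioc c d) ω) P :=
  (hW.hasGaussianLaw_Ioc a b).memLp_two.integrable_mul (hW.hasGaussianLaw_Ioc c d).memLp_two

theorem map_Ioc [IsProbabilityMeasure P] (hW : IsWhiteNoise 𝓕 P W) {a b : ℝ} (hab : a ≤ b) :
    P.map (W (Ioc a b)) = gaussianReal 0 (b - a).toNNReal := by
  have h0 : ∫ ω, W (Ioc a b) ω ∂P = 0 :=
    hW.mean_zero _ measurableSet_Ioc (volume_Ioc_lt_top _ _)
  rw [(hW.hasGaussianLaw_Ioc a b).map_eq_gaussianReal, h0,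
    variance_of_integral_eq_zero (hW.measurable_Ioc a b).aemeasurable h0]
  congr 2
  have := hW.covariance_Ioc a b a b
  rw [inter_self, Real.volume_Ioc, ENNReal.toReal_ofReal (by linarith)] at this
  rw [← this]
  exact integral_congr_ae (.of_forall fun ω => by simp [pow_two])

/-- Additivity is not assumed of W; it holds almost surely because the covariance formula makes the
second moment of the defect vanish. -/
theorem Ioc_add_ae_eq (hW : IsWhiteNoise 𝓕 P W) {a b c : ℝ} (hab : a ≤ b) (hbc : b ≤ c) :
    W (Ioc a c) =ᵐ[P] fun ω => W (Ioc a b) ω + W (Ioc b c) ω := by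
  have h : ∫ ω, (W (Ioc a c) ω - (W (Ioc a b) ω + W (Ioc b c) ω)) ^ 2 ∂P = 0 := by
    have e : ∀ ω, (W (Ioc a c) ω - (W (Ioc a b) ω + W (Ioc b c) ω)) ^ 2 =
        W (Ioc a c) ω * W (Ioc a c) ω + W (Ioc a b) ω * W (Ioc a b) ω +
        W (Ioc b c) ω * W (Ioc b c) ω + 2 * (W (Ioc a b) ω * W (Ioc b c) ω) -
        2 * (W (Ioc a c) ω * W (Ioc a b) ω) - 2 * (W (Ioc a c) ω * W (Ioc b c) ω) := fun ω => by
      ring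
    simp_rw [e]
    have I := hW.integrable_mul_Ioc
    rw [integral_quadratic (I _ _ _ _) (I _ _ _ _) (I _ _ _ _) (I _ _ _ _) (I _ _ _ _) (I _ _ _ _)]
    simp only [hW.covariance_Ioc, inter_self]
    have e1 : Ioc a c ∩ Ioc a b = Ioc a b :=
      inter_eq_right.2 (Ioc_subset_Ioc_right hbc)
    have e2 : Ioc a c ∩ Ioc b c = Ioc b c := inter_eq_right.2 (Ioc_subset_Ioc_left hab)
    have e3 : Ioc a b ∩ Ioc b c = ∅ := by
      rw [← disjoint_iff_inter_eq_empty]; exact Ioc_disjoint_Ioc_of_le le_rfl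
    rw [e1, e2, e3]
    simp only [Real.volume_Ioc, measure_empty, ENNReal.toReal_zero]
    rw [ENNReal.toReal_ofReal (by linarith), ENNReal.toReal_ofReal (by linarith),
      ENNReal.toReal_ofReal (by linarith)]
    ring
  have hint : Integrable (fun ω => (W (Ioc a c) ω - (W (Ioc a b) ω + W (Ioc b c) ω)) ^ 2) P :=
    ((hW.hasGaussianLaw_Ioc a c).memLp_two.sub ((hW.hasGaussianLaw_Ioc a b).memLp_two.add
      (hW.hasGaussianLaw_Ioc b c).memLp_two)).integrable_sq
  rw [integral_eq_zero_iff_of_nonneg (fun _ => sq_nonneg _) hint] at h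
  filter_upwards [h] with ω hω
  have : W (Ioc a c) ω - (W (Ioc a b) ω + W (Ioc b c) ω) = 0 := pow_eq_zero_iff two_ne_zero |>.1 hω
  linarith

theorem sum_Ico_ae_eq [IsProbabilityMeasure P] (hW : IsWhiteNoise 𝓕 P W) {u : ℕ → ℝ}
    (hu : Monotone u) {p q : ℕ} (hpq : p ≤ q) :
    W (Ioc (u p) (u q)) =ᵐ[P] fun ω => ∑ m ∈ Finset.Ico p q, W (Ioc (u m) (u (m + 1))) ω := by
  induction q, hpq using Nat.le_induction with
  | base =>
    -- On a degenerate interval additivity reads w = w + w, which forces w = 0.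
    have := hW.Ioc_add_ae_eq (le_refl (u p)) (le_refl (u p))
    filter_upwards [this] with ω hω
    simp only [Finset.Ico_self, Finset.sum_empty]
    linarith
  | succ q hpq ih =>
    filter_upwards [ih, hW.Ioc_add_ae_eq (hu hpq) (hu q.le_succ)] with ω h1 h2
    rw [h2, h1, Finset.sum_Ico_succ_top hpq]

end IsWhiteNoise

/-! ### Exponential martingales of simple integrands -/

theorem lintegral_exp_gaussianReal (v : ℝ≥0) (t : ℝ) :
    ∫⁻ w, ENNReal.ofReal (Real.exp (t * w - t ^ 2 / 2 * v)) ∂gaussianReal 0 v = 1 := by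
  have h := congrFun (mgf_id_gaussianReal (μ := 0) (v := v)) t
  rw [mgf] at h
  rw [← ofReal_integral_eq_lintegral_ofReal]
  · simp_rw [Real.exp_sub, div_eq_mul_inv, integral_mul_const]
    simp only [id] at h
    rw [h, ← Real.exp_neg, ← Real.exp_add]
    ring_nf
    simp
  · simp_rw [Real.exp_sub, div_eq_mul_inv]
    exact (integrable_exp_mul_gaussianReal t).mul_const _
  · exact .of_forall fun _ => (Real.exp_pos _).le

/-- Integrating out Z first, with (E, X) held fixed, leaves a normalised Gaussian exponential of
mean 1. -/
theorem lintegral_mul_exp_of_indepFun [IsProbabilityMeasure P] {E X Z : Ω → ℝ}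
    (hE : Measurable E) (hX : Measurable X) (hZ : Measurable Z) {v : ℝ≥0}
    (hlaw : P.map Z = gaussianReal 0 v) (hind : IndepFun (fun ω => (E ω, X ω)) Z P) :
    ∫⁻ ω, ENNReal.ofReal (E ω) * ENNReal.ofReal (Real.exp (X ω * Z ω - X ω ^ 2 / 2 * v)) ∂P =
      ∫⁻ ω, ENNReal.ofReal (E ω) ∂P := by
  have hEX : Measurable fun ω => (E ω, X ω) := hE.prodMk hX
  have hmap := (indepFun_iff_map_prod_eq_prod_map_map hEX.aemeasurable hZ.aemeasurable).1 hind
  have hF : Measurable fun y : (ℝ × ℝ) × ℝ => ENNReal.ofReal y.1.1 *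
      ENNReal.ofReal (Real.exp (y.1.2 * y.2 - y.1.2 ^ 2 / 2 * v)) := by fun_prop
  calc _ = ∫⁻ y, ENNReal.ofReal y.1.1 *
      ENNReal.ofReal (Real.exp (y.1.2 * y.2 - y.1.2 ^ 2 / 2 * v))
        ∂(P.map fun ω => ((E ω, X ω), Z ω)) := by
        rw [lintegral_map hF (hEX.prodMk hZ)]
    _ = ∫⁻ x, ∫⁻ z, ENNReal.ofReal x.1 * ENNReal.ofReal (Real.exp (x.2 * z - x.2 ^ 2 / 2 * v))
          ∂gaussianReal 0 v ∂(P.map fun ω => (E ω, X ω)) := by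
        rw [hmap, hlaw, lintegral_prod _ hF.aemeasurable]
    _ = ∫⁻ x, ENNReal.ofReal x.1 ∂(P.map fun ω => (E ω, X ω)) := by
        refine lintegral_congr fun x => ?_
        rw [lintegral_const_mul _ (by fun_prop), lintegral_exp_gaussianReal, mul_one]
    _ = _ := by rw [lintegral_map (by fun_prop) hEX]

namespace SimpleIntegrand

theorem measurable_ξ' (S : SimpleIntegrand 𝓕) (i : ℕ) : Measurable (S.ξ i) :=
  (S.measurable_ξ i).mono (𝓕.le _) le_rfl

theorem measurable_integral (S : SimpleIntegrand 𝓕) (hW : IsWhiteNoise 𝓕 P W) :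
    Measurable (S.integral W) := by
  unfold integral
  exact Finset.measurable_fun_sum _ fun i _ => (S.measurable_ξ' i).mul (hW.measurable_Ioc _ _)

/-- The integral over time of the square of a simple integrand. -/
def energy (S : SimpleIntegrand 𝓕) (ω : Ω) : ℝ :=
  ∑ i ∈ Finset.range S.N, S.ξ i ω ^ 2 * (S.time (i + 1) - S.time i)

theorem measurable_energy (S : SimpleIntegrand 𝓕) : Measurable S.energy := by
  unfold energy
  exact Finset.measurable_fun_sum _ fun i _ => ((S.measurable_ξ' i).pow_const 2).mul_const _

/-- The next increment of W is independent of `𝓕 (S.time n)`, with respect to which both the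
exponential so far and the coefficient `S.ξ n` are measurable; so each step preserves the mean. -/
theorem lintegral_exp_integral [IsProbabilityMeasure P] (S : SimpleIntegrand 𝓕)
    (hW : IsWhiteNoise 𝓕 P W) (l : ℝ) :
    ∫⁻ ω, ENNReal.ofReal (Real.exp (l * S.integral W ω - l ^ 2 / 2 * S.energy ω)) ∂P = 1 := by
  let e : ℕ → Ω → ℝ := fun n ω => Real.exp (l * (∑ i ∈ Finset.range n,
    S.ξ i ω * W (Ioc (S.time i) (S.time (i + 1))) ω) -
    l ^ 2 / 2 * ∑ i ∈ Finset.range n, S.ξ i ω ^ 2 * (S.time (i + 1) - S.time i))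
  have hmeas : ∀ n, Measurable[𝓕 (S.time n)] (e n) := by
    intro n
    have h1 : ∀ i ∈ Finset.range n, Measurable[𝓕 (S.time n)] (S.ξ i) := fun i hi =>
      (S.measurable_ξ i).mono (𝓕.mono (S.mono (Finset.mem_range.1 hi).le)) le_rfl
    have h2 : ∀ i ∈ Finset.range n,
        Measurable[𝓕 (S.time n)] (W (Ioc (S.time i) (S.time (i + 1)))) := fun i hi =>
      hW.adapted _ _ measurableSet_Ioc (volume_Ioc_lt_top _ _)
        (Ioc_subset_Iic_self.trans (Iic_subset_Iic.2 (S.mono (Finset.mem_range.1 hi))))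
    refine Real.measurable_exp.comp (Measurable.sub (Measurable.const_mul
      (Finset.measurable_fun_sum _ fun i hi => (h1 i hi).mul (h2 i hi)) _)
      (Measurable.const_mul
      (Finset.measurable_fun_sum _ fun i hi => ((h1 i hi).pow_const 2).mul_const _) _))
  have hstep : ∀ n, ∫⁻ ω, ENNReal.ofReal (e n ω) ∂P = 1 := by
    intro n
    induction n with
    | zero => simp [e]
    | succ n ih =>
      have hle : S.time n ≤ S.time (n + 1) := S.mono n.le_succ
      rw [← ih, ← lintegral_mul_exp_of_indepFun (E := e n) (X := fun ω => l * S.ξ n ω)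
        (Z := W (Ioc (S.time n) (S.time (n + 1)))) ((hmeas n).mono (𝓕.le _) le_rfl)
        ((S.measurable_ξ' n).const_mul l) (hW.measurable_Ioc _ _)
        (hW.map_Ioc hle)]
      · refine lintegral_congr fun ω => ?_
        rw [← ENNReal.ofReal_mul (Real.exp_pos _).le, ← Real.exp_add,
          Real.coe_toNNReal _ (sub_nonneg.2 hle)]
        simp only [e, Finset.sum_range_succ]
        ring_nf
      · have hi := hW.indep (S.time n) (Ioc (S.time n) (S.time (n + 1))) measurableSet_Ioc
          (volume_Ioc_lt_top _ _) fun x hx => hx.1.le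
        rw [IndepFun_iff_Indep]
        refine indep_of_indep_of_le_left hi.symm ?_
        exact measurable_iff_comap_le.1 ((hmeas n).prodMk ((S.measurable_ξ n).const_mul l))
  exact hstep S.N

theorem measurable_eval (S : SimpleIntegrand 𝓕) (ω : Ω) : Measurable fun s => S.eval s ω := by
  unfold eval
  exact Finset.measurable_fun_sum _ fun i _ => measurable_const.indicator measurableSet_Ioc

theorem eval_sq (S : SimpleIntegrand 𝓕) (s : ℝ) (ω : Ω) :
    S.eval s ω ^ 2 = ∑ i ∈ Finset.range S.N,
      (Ioc (S.time i) (S.time (i + 1))).indicator (fun _ => S.ξ i ω ^ 2) s := by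
  rw [eval, sq, Finset.sum_mul_sum]
  refine Finset.sum_congr rfl fun i hi => ?_
  rw [Finset.sum_eq_single_of_mem i hi]
  · by_cases h : s ∈ Ioc (S.time i) (S.time (i + 1)) <;> simp [h, sq]
  · intro j _ hji
    have hd : Disjoint (Ioc (S.time i) (S.time (i + 1))) (Ioc (S.time j) (S.time (j + 1))) :=
      S.mono.pairwise_disjoint_on_Ioc_succ hji.symm
    by_cases h : s ∈ Ioc (S.time i) (S.time (i + 1))
    · rw [indicator_of_notMem (disjoint_left.1 hd h), mul_zero]
    · rw [indicator_of_notMem h, zero_mul]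

theorem lintegral_eval_sq (S : SimpleIntegrand 𝓕) (ω : Ω) :
    ∫⁻ s, ENNReal.ofReal (S.eval s ω ^ 2) = ENNReal.ofReal (S.energy ω) := by
  have h1 : ∀ s, ENNReal.ofReal (S.eval s ω ^ 2) = ∑ i ∈ Finset.range S.N,
      (Ioc (S.time i) (S.time (i + 1))).indicator (fun _ => ENNReal.ofReal (S.ξ i ω ^ 2)) s := by
    intro s
    rw [eval_sq, ENNReal.ofReal_sum_of_nonneg fun i _ =>
      indicator_nonneg (fun _ _ => sq_nonneg _) _]
    refine Finset.sum_congr rfl fun i _ => ?_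
    by_cases h : s ∈ Ioc (S.time i) (S.time (i + 1)) <;> simp [h]
  simp_rw [h1]
  rw [lintegral_finsetSum _ fun i _ => measurable_const.indicator measurableSet_Ioc, energy,
    ENNReal.ofReal_sum_of_nonneg fun i _ =>
      mul_nonneg (sq_nonneg _) (sub_nonneg.2 (S.mono i.le_succ))]
  refine Finset.sum_congr rfl fun i _ => ?_
  rw [lintegral_indicator measurableSet_Ioc, setLIntegral_const, Real.volume_Ioc,
    ENNReal.ofReal_mul (sq_nonneg _)]

/-- A simple integrand with its coefficients frozen at the values they have at a sample point. -/
def freeze (S : SimpleIntegrand 𝓕) (ω₀ : Ω) : SimpleIntegrand 𝓕 where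
  N := S.N
  time := S.time
  mono := S.mono
  ξ i _ := S.ξ i ω₀
  measurable_ξ _ := measurable_const
  bounded_ξ := by
    obtain ⟨C, hC⟩ := S.bounded_ξ
    exact ⟨C, fun i _ => hC i ω₀⟩

/-- The Itô isometry for deterministic simple integrands. -/
theorem integral_freeze_sq (S : SimpleIntegrand 𝓕) (hW : IsWhiteNoise 𝓕 P W) (ω₀ : Ω) :
    ∫ ω, ((S.freeze ω₀).integral W ω) ^ 2 ∂P = S.energy ω₀ := by
  have e : ∀ ω, ((S.freeze ω₀).integral W ω) ^ 2 = ∑ i ∈ Finset.range S.N,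
      ∑ j ∈ Finset.range S.N, S.ξ i ω₀ * S.ξ j ω₀ *
        (W (Ioc (S.time i) (S.time (i + 1))) ω * W (Ioc (S.time j) (S.time (j + 1))) ω) := by
    intro ω
    rw [integral, sq, Finset.sum_mul_sum]
    refine Finset.sum_congr rfl fun i _ => Finset.sum_congr rfl fun j _ => ?_
    simp only [freeze]
    ring
  simp_rw [e]
  rw [integral_finsetSum _ fun i _ => integrable_finsetSum _ fun j _ =>
    (hW.integrable_mul_Ioc _ _ _ _).const_mul _]
  refine Finset.sum_congr rfl fun i hi => ?_
  rw [integral_finsetSum _ fun j _ => (hW.integrable_mul_Ioc _ _ _ _).const_mul _]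
  simp only [integral_const_mul, hW.covariance_Ioc]
  rw [Finset.sum_eq_single_of_mem i hi]
  · rw [inter_self, Real.volume_Ioc, ENNReal.toReal_ofReal (sub_nonneg.2 (S.mono i.le_succ)), sq]
  · intro j _ hji
    have hd : Disjoint (Ioc (S.time i) (S.time (i + 1))) (Ioc (S.time j) (S.time (j + 1))) :=
      S.mono.pairwise_disjoint_on_Ioc_succ hji.symm
    rw [disjoint_iff_inter_eq_empty.1 hd]
    simp

end SimpleIntegrand

/-! ### Linear combinations of simple integrands -/

theorem sum_Ico_indicator_Ioc {u : ℕ → ℝ} (hu : Monotone u) {p q : ℕ} (hpq : p ≤ q) (c s : ℝ) :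
    ∑ m ∈ Finset.Ico p q, (Ioc (u m) (u (m + 1))).indicator (fun _ => c) s =
      (Ioc (u p) (u q)).indicator (fun _ => c) s := by
  induction q, hpq using Nat.le_induction with
  | base => simp
  | succ q hpq ih =>
    rw [Finset.sum_Ico_succ_top hpq, ih,
      ← Ioc_union_Ioc_eq_Ioc (hu hpq) (hu q.le_succ),
      indicator_union_of_disjoint (Ioc_disjoint_Ioc_of_le le_rfl)]

theorem sum_range_ite_eq_sum_Ico {p q M : ℕ} (hq : q ≤ M) (f : ℕ → ℝ) :
    ∑ m ∈ Finset.range M, (if p ≤ m ∧ m < q then f m else 0) = ∑ m ∈ Finset.Ico p q, f m := by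
  rw [← Finset.sum_filter]
  refine Finset.sum_congr ?_ fun _ _ => rfl
  ext m
  simp only [Finset.mem_filter, Finset.mem_range, Finset.mem_Ico]
  omega

namespace SimpleIntegrand

/-- Adding simple integrands requires a common partition. A fine interval inherits the coefficient
of the coarse one containing it, which is already known at the later left endpoint `u m`. -/
theorem exists_refinement [IsProbabilityMeasure P] (S : SimpleIntegrand 𝓕)
    (hW : IsWhiteNoise 𝓕 P W) {u : ℕ → ℝ} (hu : Monotone u) {M : ℕ}
    (hM : ∀ i ≤ S.N, ∃ m ≤ M, u m = S.time i) :
    ∃ S' : SimpleIntegrand 𝓕, S'.N = M ∧ S'.time = u ∧ (∀ s ω, S'.eval s ω = S.eval s ω) ∧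
      S'.integral W =ᵐ[P] S.integral W := by
  have hM' : ∀ i, ∃ m, i ≤ S.N → m ≤ M ∧ u m = S.time i := by
    intro i
    by_cases hi : i ≤ S.N
    · obtain ⟨m, h⟩ := hM i hi; exact ⟨m, fun _ => h⟩
    · exact ⟨0, fun h => absurd h hi⟩
  choose idx hidx using hM'
  -- Equal times may receive indices in the wrong order; the coarse interval is then empty and
  -- contributes nothing.
  have hcase : ∀ i < S.N, idx i ≤ idx (i + 1) ∨
      (Finset.Ico (idx i) (idx (i + 1)) = ∅ ∧ S.time i = S.time (i + 1)) := by
    intro i hi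
    rcases le_total (idx i) (idx (i + 1)) with h | h
    · exact Or.inl h
    · refine Or.inr ⟨Finset.Ico_eq_empty_of_le h, le_antisymm (S.mono i.le_succ) ?_⟩
      rw [← (hidx i hi.le).2, ← (hidx (i + 1) hi).2]
      exact hu h
  let ξ' : ℕ → Ω → ℝ := fun m ω => ∑ i ∈ Finset.range S.N,
    if idx i ≤ m ∧ m < idx (i + 1) then S.ξ i ω else 0
  refine ⟨⟨M, u, hu, ξ', fun m => ?_, ?_⟩, rfl, rfl, fun s ω => ?_, ?_⟩
  · refine Finset.measurable_fun_sum _ fun i hi => ?_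
    by_cases h : idx i ≤ m ∧ m < idx (i + 1)
    · simp only [h, and_self, if_true]
      refine (S.measurable_ξ i).mono (𝓕.mono ?_) le_rfl
      rw [← (hidx i (Finset.mem_range.1 hi).le).2]
      exact hu h.1
    · simp only [h, if_false]
      exact measurable_const
  · obtain ⟨C, hC⟩ := S.bounded_ξ
    refine ⟨∑ i ∈ Finset.range S.N, |C|, fun m ω => ?_⟩
    refine (Finset.abs_sum_le_sum_abs _ _).trans (Finset.sum_le_sum fun i _ => ?_)
    split_ifs
    · exact (hC i ω).trans (le_abs_self C)
    · simp
  · have h1 : ∀ m, (Ioc (u m) (u (m + 1))).indicator (fun _ => ξ' m ω) s =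
        ∑ i ∈ Finset.range S.N, if idx i ≤ m ∧ m < idx (i + 1) then
          (Ioc (u m) (u (m + 1))).indicator (fun _ => S.ξ i ω) s else 0 := by
      intro m
      by_cases h : s ∈ Ioc (u m) (u (m + 1))
      · simp only [indicator_of_mem h, ξ']
      · simp only [indicator_of_notMem h, ite_self, Finset.sum_const_zero]
    simp only [eval, h1]
    rw [Finset.sum_comm]
    refine Finset.sum_congr rfl fun i hi => ?_
    have hi' := Finset.mem_range.1 hi
    rw [sum_range_ite_eq_sum_Ico (hidx (i + 1) hi').1]
    rcases hcase i hi' with h | ⟨h, h'⟩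
    · rw [sum_Ico_indicator_Ioc hu h, (hidx i hi'.le).2, (hidx (i + 1) hi').2]
    · simp [h, h']
  · have h1 : ∀ i ∈ Finset.range S.N, W (Ioc (S.time i) (S.time (i + 1))) =ᵐ[P]
        fun ω => ∑ m ∈ Finset.Ico (idx i) (idx (i + 1)), W (Ioc (u m) (u (m + 1))) ω := by
      intro i hi
      have hi' := Finset.mem_range.1 hi
      rcases hcase i hi' with h | ⟨h, h'⟩
      · rw [← (hidx i hi'.le).2, ← (hidx (i + 1) hi').2]
        exact hW.sum_Ico_ae_eq hu h
      · rw [h, ← h']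
        filter_upwards [hW.Ioc_add_ae_eq (le_refl (S.time i)) (le_refl (S.time i))] with ω hω
        simp only [Finset.sum_empty]
        linarith
    have h2 := (Finset.eventually_all (Finset.range S.N)).2 h1
    filter_upwards [h2] with ω hω
    simp only [integral, ξ', Finset.sum_mul]
    rw [Finset.sum_comm]
    refine Finset.sum_congr rfl fun i hi => ?_
    simp only [ite_mul, zero_mul]
    rw [sum_range_ite_eq_sum_Ico (hidx (i + 1) (Finset.mem_range.1 hi)).1, hω i hi,
      Finset.mul_sum]

theorem exists_monotone_enumeration (F : Finset ℝ) :
    ∃ u : ℕ → ℝ, Monotone u ∧ ∃ M : ℕ, ∀ x ∈ F, ∃ m ≤ M, u m = x := by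
  rcases F.eq_empty_or_nonempty with rfl | hF
  · exact ⟨fun _ => 0, monotone_const, 0, by simp⟩
  have hc : 0 < F.card := hF.card_pos
  -- The increasing list of the elements of F, held constant after its last entry so as to be
  -- monotone on all of ℕ.
  refine ⟨fun m => F.orderEmbOfFin rfl ⟨min m (F.card - 1), by omega⟩, fun a b hab => ?_,
    F.card, fun x hx => ?_⟩
  · refine (F.orderEmbOfFin rfl).monotone ?_
    rw [Fin.mk_le_mk]
    omega
  · have : x ∈ Set.range (F.orderEmbOfFin rfl) := by
      rw [Finset.range_orderEmbOfFin]; exact hx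
    obtain ⟨m, rfl⟩ := this
    refine ⟨m, m.2.le, ?_⟩
    have : min (m : ℕ) (F.card - 1) = m := by omega
    simp only [this]

theorem exists_add [IsProbabilityMeasure P] (S₁ S₂ : SimpleIntegrand 𝓕)
    (hW : IsWhiteNoise 𝓕 P W) :
    ∃ S : SimpleIntegrand 𝓕, (∀ s ω, S.eval s ω = S₁.eval s ω + S₂.eval s ω) ∧
      S.integral W =ᵐ[P] fun ω => S₁.integral W ω + S₂.integral W ω := by
  classical
  obtain ⟨u, hu, M, hM⟩ := exists_monotone_enumeration
    ((Finset.range (S₁.N + 1)).image S₁.time ∪ (Finset.range (S₂.N + 1)).image S₂.time)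
  obtain ⟨R₁, hN₁, hT₁, he₁, hi₁⟩ := S₁.exists_refinement hW hu (M := M) fun i hi => hM _
    (Finset.mem_union_left _ (Finset.mem_image_of_mem _ (Finset.mem_range.2 (by omega))))
  obtain ⟨R₂, hN₂, hT₂, he₂, hi₂⟩ := S₂.exists_refinement hW hu (M := M) fun i hi => hM _
    (Finset.mem_union_right _ (Finset.mem_image_of_mem _ (Finset.mem_range.2 (by omega))))
  refine ⟨⟨M, u, hu, fun i ω => R₁.ξ i ω + R₂.ξ i ω, fun i => ?_, ?_⟩, fun s ω => ?_, ?_⟩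
  · have h1 := R₁.measurable_ξ i
    have h2 := R₂.measurable_ξ i
    rw [hT₁] at h1
    rw [hT₂] at h2
    exact h1.add h2
  · obtain ⟨C₁, h₁⟩ := R₁.bounded_ξ
    obtain ⟨C₂, h₂⟩ := R₂.bounded_ξ
    exact ⟨C₁ + C₂, fun i ω => (abs_add_le _ _).trans (add_le_add (h₁ i ω) (h₂ i ω))⟩
  · rw [← he₁, ← he₂]
    simp only [eval, hN₁, hN₂, hT₁, hT₂]
    rw [← Finset.sum_add_distrib]
    refine Finset.sum_congr rfl fun i _ => ?_
    by_cases h : s ∈ Ioc (u i) (u (i + 1)) <;> simp [h]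
  · filter_upwards [hi₁, hi₂] with ω h₁ h₂
    rw [← h₁, ← h₂]
    simp only [integral, hN₁, hN₂, hT₁, hT₂]
    rw [← Finset.sum_add_distrib]
    refine Finset.sum_congr rfl fun i _ => ?_
    ring

/-- A scalar multiple of a simple integrand. -/
def smul (c : ℝ) (S : SimpleIntegrand 𝓕) : SimpleIntegrand 𝓕 where
  N := S.N
  time := S.time
  mono := S.mono
  ξ i ω := c * S.ξ i ω
  measurable_ξ i := (S.measurable_ξ i).const_mul c
  bounded_ξ := by
    obtain ⟨C, hC⟩ := S.bounded_ξ
    refine ⟨|c| * C, fun i ω => ?_⟩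
    rw [abs_mul]
    exact mul_le_mul_of_nonneg_left (hC i ω) (abs_nonneg c)

theorem smul_eval (c : ℝ) (S : SimpleIntegrand 𝓕) (s : ℝ) (ω : Ω) :
    (S.smul c).eval s ω = c * S.eval s ω := by
  simp only [eval, smul, Finset.mul_sum]
  refine Finset.sum_congr rfl fun i _ => ?_
  by_cases h : s ∈ Ioc (S.time i) (S.time (i + 1)) <;> simp [h]

theorem smul_integral (c : ℝ) (S : SimpleIntegrand 𝓕) (ω : Ω) :
    (S.smul c).integral W ω = c * S.integral W ω := by
  simp only [integral, smul, Finset.mul_sum, mul_assoc]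

/-- The zero integrand. -/
def zero : SimpleIntegrand 𝓕 where
  N := 0
  time _ := 0
  mono := monotone_const
  ξ _ _ := 0
  measurable_ξ _ := measurable_const
  bounded_ξ := ⟨0, by simp⟩

end SimpleIntegrand

/-! ### Linear combinations of Itô integrals -/

/-- Serves both convergences in `IsItoIntegral`: squared distances of integrands and distances of
integrals. -/
theorem tendsto_measure_le_of_le_mul_add {f₁ f₂ f : ℕ → Ω → ℝ≥0∞} {K : ℝ≥0∞} (hK : K ≠ ∞)
    (hf : ∀ n, ∀ᵐ ω ∂P, f n ω ≤ K * (f₁ n ω + f₂ n ω))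
    (h₁ : ∀ ε : ℝ≥0∞, 0 < ε → Tendsto (fun n => P {ω | ε ≤ f₁ n ω}) atTop (𝓝 0))
    (h₂ : ∀ ε : ℝ≥0∞, 0 < ε → Tendsto (fun n => P {ω | ε ≤ f₂ n ω}) atTop (𝓝 0))
    (ε : ℝ≥0∞) (hε : 0 < ε) : Tendsto (fun n => P {ω | ε ≤ f n ω}) atTop (𝓝 0) := by
  have hK1 : K + 1 ≠ ∞ := ENNReal.add_ne_top.2 ⟨hK, ENNReal.one_ne_top⟩
  -- `K + 1` rather than `K` keeps the divisor nonzero.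
  set η := ε / (K + 1) / 2
  have hη : 0 < η := ENNReal.div_pos (ENNReal.div_pos hε.ne' hK1).ne' ENNReal.ofNat_ne_top
  have h := (h₁ η hη).add (h₂ η hη)
  rw [add_zero] at h
  refine tendsto_of_tendsto_of_tendsto_of_le_of_le tendsto_const_nhds h (fun _ => zero_le)
    fun n => ?_
  refine (measure_mono_ae ?_).trans (measure_union_le _ _)
  filter_upwards [hf n] with ω hω hmem
  by_contra hcon
  have hcon : ¬ (η ≤ f₁ n ω ∨ η ≤ f₂ n ω) := hcon
  rw [not_or] at hcon
  have a₁ : f₁ n ω < η := not_le.1 hcon.1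
  have a₂ : f₂ n ω < η := not_le.1 hcon.2
  have a₃ : f₁ n ω + f₂ n ω < ε / (K + 1) := by
    rw [← ENNReal.add_halves (ε / (K + 1))]
    exact ENNReal.add_lt_add a₁ a₂
  have a₄ : (f₁ n ω + f₂ n ω) * (K + 1) < ε :=
    (ENNReal.lt_div_iff_mul_lt (Or.inl (by simp)) (Or.inl hK1)).1 a₃
  have a₅ : ε ≤ f n ω := hmem
  refine absurd (a₅.trans hω) (not_le.2 (lt_of_le_of_lt ?_ a₄))
  rw [mul_comm]
  gcongr
  exact le_self_add

theorem lintegral_ofReal_add_sq_le {f g : ℝ → ℝ} (hf : Measurable f) :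
    ∫⁻ s, ENNReal.ofReal ((f s + g s) ^ 2) ≤
      2 * ((∫⁻ s, ENNReal.ofReal (f s ^ 2)) + ∫⁻ s, ENNReal.ofReal (g s ^ 2)) := by
  rw [← lintegral_add_left (by fun_prop), ← lintegral_const_mul' _ _ (by simp)]
  refine lintegral_mono fun s => ?_
  rw [← ENNReal.ofReal_add (sq_nonneg _) (sq_nonneg _),
    show (2 : ℝ≥0∞) = ENNReal.ofReal 2 by simp, ← ENNReal.ofReal_mul (by norm_num)]
  exact ENNReal.ofReal_le_ofReal (by nlinarith [sq_nonneg (f s - g s)])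

namespace IsItoIntegral

variable {H H₁ H₂ : ℝ → Ω → ℝ} {Y Y₁ Y₂ : Ω → ℝ}

theorem of_simpleIntegrand (S : SimpleIntegrand 𝓕) :
    IsItoIntegral 𝓕 P W (fun s ω => S.eval s ω) (S.integral W) :=
  ⟨fun _ => S, fun ε hε => by simp [hε.not_ge], fun ε hε => by simp [hε.not_ge]⟩

theorem add [IsProbabilityMeasure P] (hW : IsWhiteNoise 𝓕 P W)
    (h₁ : IsItoIntegral 𝓕 P W H₁ Y₁) (h₂ : IsItoIntegral 𝓕 P W H₂ Y₂)
    (hm : ∀ ω, Measurable fun s => H₁ s ω) :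
    IsItoIntegral 𝓕 P W (fun s ω => H₁ s ω + H₂ s ω) (fun ω => Y₁ ω + Y₂ ω) := by
  obtain ⟨S₁, hS₁, hI₁⟩ := h₁
  obtain ⟨S₂, hS₂, hI₂⟩ := h₂
  choose S he hi using fun n => (S₁ n).exists_add (S₂ n) hW
  refine ⟨S, ?_, ?_⟩
  · refine tendsto_measure_le_of_le_mul_add (K := 2) (by simp) (fun n => ?_) hS₁ hS₂
    refine .of_forall fun ω => ?_
    refine (lintegral_mono fun s => ?_).trans
      (lintegral_ofReal_add_sq_le (f := fun s => (S₁ n).eval s ω - H₁ s ω)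
        (g := fun s => (S₂ n).eval s ω - H₂ s ω) (((S₁ n).measurable_eval ω).sub (hm ω)))
    rw [he]
    exact le_of_eq (by ring_nf)
  · refine tendsto_measure_le_of_le_mul_add (K := 1) (by simp) (fun n => ?_) hI₁ hI₂
    filter_upwards [hi n] with ω hω
    rw [hω, one_mul]
    exact edist_add_add_le _ _ _ _

theorem const_mul (c : ℝ) (h : IsItoIntegral 𝓕 P W H Y) :
    IsItoIntegral 𝓕 P W (fun s ω => c * H s ω) (fun ω => c * Y ω) := by
  obtain ⟨S, hS, hI⟩ := h
  refine ⟨fun n => (S n).smul c, ?_, ?_⟩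
  · refine tendsto_measure_le_of_le_mul_add (K := ENNReal.ofReal (c ^ 2)) (by simp)
      (fun n => .of_forall fun ω => ?_) hS hS
    refine le_trans ?_ (mul_le_mul_right le_self_add _)
    rw [← lintegral_const_mul' _ _ (by simp)]
    refine lintegral_mono fun s => ?_
    rw [SimpleIntegrand.smul_eval, ← ENNReal.ofReal_mul (sq_nonneg c)]
    exact le_of_eq (by ring_nf)
  · refine tendsto_measure_le_of_le_mul_add (K := ENNReal.ofReal |c|) (by simp)
      (fun n => .of_forall fun ω => ?_) hI hI
    refine le_trans ?_ (mul_le_mul_right le_self_add _)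
    change edist (((S n).smul c).integral W ω) (c * Y ω) ≤ _
    rw [SimpleIntegrand.smul_integral, edist_dist, edist_dist, Real.dist_eq, Real.dist_eq,
      ← ENNReal.ofReal_mul (abs_nonneg c), ← abs_mul, mul_sub]

theorem sum [IsProbabilityMeasure P] (hW : IsWhiteNoise 𝓕 P W) {ι : Type*} (s : Finset ι)
    {H : ι → ℝ → Ω → ℝ} {Y : ι → Ω → ℝ} (h : ∀ i ∈ s, IsItoIntegral 𝓕 P W (H i) (Y i))
    (hm : ∀ i ∈ s, ∀ ω, Measurable fun t => H i t ω) :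
    IsItoIntegral 𝓕 P W (fun t ω => ∑ i ∈ s, H i t ω) (fun ω => ∑ i ∈ s, Y i ω) := by
  classical
  induction s using Finset.induction_on with
  | empty =>
    have := of_simpleIntegrand (P := P) (W := W) (SimpleIntegrand.zero (𝓕 := 𝓕))
    simp only [Finset.sum_empty]
    convert this using 2
    · ext ω; simp [SimpleIntegrand.eval, SimpleIntegrand.zero]
    · simp [SimpleIntegrand.integral, SimpleIntegrand.zero]
  | insert a s ha ih =>
    simp only [Finset.sum_insert ha]
    exact add hW (h a (Finset.mem_insert_self a s))
      (ih (fun i hi => h i (Finset.mem_insert_of_mem hi))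
        fun i hi => hm i (Finset.mem_insert_of_mem hi)) (hm a (Finset.mem_insert_self a s))

/-! ### Moments of Itô integrals -/

theorem aemeasurable (hW : IsWhiteNoise 𝓕 P W) (h : IsItoIntegral 𝓕 P W H Y) :
    AEMeasurable Y P := by
  obtain ⟨S, -, hI⟩ := h
  exact hI.aemeasurable fun n => ((S n).measurable_integral hW).aemeasurable

theorem exists_seq_tendsto_ae (h : IsItoIntegral 𝓕 P W H Y) :
    ∃ S : ℕ → SimpleIntegrand 𝓕,
      (∀ᵐ ω ∂P, Tendsto (fun n => ∫⁻ s, ENNReal.ofReal (((S n).eval s ω - H s ω) ^ 2))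
        atTop (𝓝 0)) ∧
      ∀ᵐ ω ∂P, Tendsto (fun n => (S n).integral W ω) atTop (𝓝 (Y ω)) := by
  obtain ⟨S, hS, hI⟩ := h
  set D : ℕ → Ω → ℝ≥0∞ := fun n ω => ∫⁻ s, ENNReal.ofReal (((S n).eval s ω - H s ω) ^ 2)
  have hmin : ∀ n ω, min (D n ω) 1 ≠ ∞ := fun n ω =>
    ne_top_of_le_ne_top ENNReal.one_ne_top (min_le_right _ _)
  -- Truncation at 1 makes the possibly infinite distances real-valued and does not affect
  -- convergence to 0.
  have hS' : TendstoInMeasure P (fun n ω => (min (D n ω) 1).toReal) atTop (fun _ => 0) := by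
    intro ε hε
    refine tendsto_of_tendsto_of_tendsto_of_le_of_le tendsto_const_nhds (hS ε hε)
      (fun _ => zero_le) fun n => measure_mono fun ω (hω : ε ≤ edist _ _) => ?_
    rw [edist_dist, Real.dist_eq, sub_zero, abs_of_nonneg ENNReal.toReal_nonneg,
      ENNReal.ofReal_toReal (hmin n ω)] at hω
    exact hω.trans (min_le_left _ _)
  obtain ⟨ns, hns, hS''⟩ := hS'.exists_seq_tendsto_ae
  obtain ⟨ms, hms, hI'⟩ := (hI.comp hns.tendsto_atTop).exists_seq_tendsto_ae
  refine ⟨fun n => S (ns (ms n)), ?_, hI'⟩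
  filter_upwards [hS''] with ω hω
  have h1 : Tendsto (fun n => min (D (ns n) ω) 1) atTop (𝓝 0) := by
    have := ENNReal.tendsto_ofReal hω
    simp only [ENNReal.ofReal_toReal (hmin _ ω), ENNReal.ofReal_zero] at this
    exact this
  have h2 : Tendsto (fun n => D (ns n) ω) atTop (𝓝 0) := by
    refine h1.congr' ?_
    filter_upwards [h1.eventually (gt_mem_nhds zero_lt_one)] with n hn
    exact min_eq_left (le_of_lt (by simpa using hn))
  exact h2.comp hms.tendsto_atTop

/-- On B the energies of the approximants are at most 2(D n + K) with D n → 0, so the compensator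
costs at most l²K in the limit. Fatou's lemma is applied on all of Ω and B enters only afterwards,
so B need not be adapted to anything. -/
theorem setLIntegral_exp_le [IsProbabilityMeasure P] (hW : IsWhiteNoise 𝓕 P W)
    (h : IsItoIntegral 𝓕 P W H Y) (hm : ∀ ω, Measurable fun s => H s ω) {B : Set Ω}
    (hB : MeasurableSet B) {K : ℝ} (hK : 0 ≤ K)
    (hHB : ∀ ω ∈ B, ∫⁻ s, ENNReal.ofReal (H s ω ^ 2) ≤ ENNReal.ofReal K) (l : ℝ) :
    ∫⁻ ω in B, ENNReal.ofReal (Real.exp (l * Y ω)) ∂P ≤ ENNReal.ofReal (Real.exp (l ^ 2 * K)) := by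
  obtain ⟨S, hS, hI⟩ := h.exists_seq_tendsto_ae
  set F : ℕ → Ω → ℝ≥0∞ := fun n ω => ENNReal.ofReal
    (Real.exp (l * (S n).integral W ω - l ^ 2 / 2 * (S n).energy ω))
  have hFm : ∀ n, Measurable (F n) := fun n =>
    ENNReal.measurable_ofReal.comp (Real.measurable_exp.comp
      ((((S n).measurable_integral hW).const_mul l).sub ((S n).measurable_energy.const_mul _)))
  have hF : ∫⁻ ω, liminf (fun n => F n ω) atTop ∂P ≤ 1 := by
    refine (lintegral_liminf_le hFm).trans ?_
    simp only [F, (S _).lintegral_exp_integral hW, liminf_const, le_refl]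
  have hae : ∀ᵐ ω ∂P.restrict B, ENNReal.ofReal (Real.exp (l * Y ω)) ≤
      ENNReal.ofReal (Real.exp (l ^ 2 * K)) * liminf (fun n => F n ω) atTop := by
    rw [ae_restrict_iff' hB]
    filter_upwards [hS, hI] with ω hSω hIω hωB
    set D : ℕ → ℝ≥0∞ := fun n => ∫⁻ s, ENNReal.ofReal (((S n).eval s ω - H s ω) ^ 2)
    have hDtop : ∀ᶠ n in atTop, D n ≠ ∞ :=
      (hSω.eventually (gt_mem_nhds ENNReal.zero_lt_top)).mono fun n hn => hn.ne
    have hDr : Tendsto (fun n => (D n).toReal) atTop (𝓝 0) := by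
      exact (ENNReal.tendsto_toReal ENNReal.zero_ne_top).comp hSω
    have hlim : Tendsto (fun n => ENNReal.ofReal (Real.exp (l * (S n).integral W ω -
        l ^ 2 / 2 * (2 * ((D n).toReal + K))))) atTop
        (𝓝 (ENNReal.ofReal (Real.exp (l * Y ω - l ^ 2 / 2 * (2 * (0 + K)))))) := by
      refine ENNReal.tendsto_ofReal ((Real.continuous_exp.tendsto _).comp ?_)
      exact (hIω.const_mul l).sub (((hDr.add_const K).const_mul 2).const_mul _)
    have hle : ENNReal.ofReal (Real.exp (l * Y ω - l ^ 2 / 2 * (2 * (0 + K)))) ≤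
        liminf (fun n => F n ω) atTop := by
      rw [← hlim.liminf_eq]
      refine liminf_le_liminf ?_
      filter_upwards [hDtop] with n hn
      have hE : (S n).energy ω ≤ 2 * ((D n).toReal + K) := by
        have h1 := lintegral_ofReal_add_sq_le (f := fun s => (S n).eval s ω - H s ω)
          (g := fun s => H s ω) (((S n).measurable_eval ω).sub (hm ω))
        simp only [sub_add_cancel] at h1
        rw [(S n).lintegral_eval_sq] at h1
        have h2 : ENNReal.ofReal ((S n).energy ω) ≤
            ENNReal.ofReal (2 * ((D n).toReal + K)) := by
          refine h1.trans ?_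
          rw [ENNReal.ofReal_mul (by norm_num), ENNReal.ofReal_add ENNReal.toReal_nonneg hK,
            ENNReal.ofReal_toReal hn, show ENNReal.ofReal 2 = 2 by simp]
          exact mul_le_mul_right (add_le_add le_rfl (hHB ω hωB)) _
        exact (ENNReal.ofReal_le_ofReal_iff (by have := (D n).toReal_nonneg; positivity)).1 h2
      refine ENNReal.ofReal_le_ofReal (Real.exp_le_exp.2 ?_)
      gcongr
    refine le_trans (le_of_eq ?_) (mul_le_mul_right hle _)
    rw [← ENNReal.ofReal_mul (Real.exp_pos _).le, ← Real.exp_add]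
    ring_nf
  calc _ ≤ ∫⁻ ω in B, ENNReal.ofReal (Real.exp (l ^ 2 * K)) * liminf (fun n => F n ω) atTop ∂P :=
        lintegral_mono_ae hae
    _ ≤ ∫⁻ ω, ENNReal.ofReal (Real.exp (l ^ 2 * K)) * liminf (fun n => F n ω) atTop ∂P :=
        setLIntegral_le_lintegral _ _
    _ = ENNReal.ofReal (Real.exp (l ^ 2 * K)) * ∫⁻ ω, liminf (fun n => F n ω) atTop ∂P :=
        lintegral_const_mul' _ _ ENNReal.ofReal_ne_top
    _ ≤ _ := by
        simpa using mul_le_mul_right hF (ENNReal.ofReal (Real.exp (l ^ 2 * K)))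

/-- A Burkholder-type inequality on an event where the quadratic variation is bounded. -/
theorem setLIntegral_rpow_le [IsProbabilityMeasure P] (hW : IsWhiteNoise 𝓕 P W)
    (h : IsItoIntegral 𝓕 P W H Y) (hm : ∀ ω, Measurable fun s => H s ω) {B : Set Ω}
    (hB : MeasurableSet B) {K : ℝ} (hK : 0 < K)
    (hHB : ∀ ω ∈ B, ∫⁻ s, ENNReal.ofReal (H s ω ^ 2) ≤ ENNReal.ofReal (K ^ 2)) {q : ℝ}
    (hq : 0 < q) :
    ∫⁻ ω in B, ENNReal.ofReal (|Y ω| ^ q) ∂P ≤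
      ENNReal.ofReal (2 * Real.exp 1 * q ^ q * K ^ q) := by
  -- The choice l = ±1/K turns the exponential bound into the constant e.
  have hexp : ∀ l : ℝ, l ^ 2 * K ^ 2 = 1 →
      ∫⁻ ω in B, ENNReal.ofReal (Real.exp (l * Y ω)) ∂P ≤ ENNReal.ofReal (Real.exp 1) := by
    intro l hl
    have := h.setLIntegral_exp_le hW hm hB (sq_nonneg K) hHB l
    rwa [hl] at this
  have h1 := hexp (1 / K) (by field_simp)
  have h2 := hexp (-(1 / K)) (by field_simp)
  have hYm : AEMeasurable Y (P.restrict B) := (h.aemeasurable hW).restrict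
  calc ∫⁻ ω in B, ENNReal.ofReal (|Y ω| ^ q) ∂P
      ≤ ∫⁻ ω in B, ENNReal.ofReal (q ^ q * K ^ q) * (ENNReal.ofReal (Real.exp (1 / K * Y ω)) +
          ENNReal.ofReal (Real.exp (-(1 / K) * Y ω))) ∂P := by
        refine lintegral_mono fun ω => ?_
        rw [← ENNReal.ofReal_add (Real.exp_pos _).le (Real.exp_pos _).le,
          ← ENNReal.ofReal_mul (by positivity)]
        refine ENNReal.ofReal_le_ofReal ?_
        have := rpow_abs_le_exp hq (1 / K * Y ω)
        rw [abs_mul, abs_of_pos (by positivity : 0 < 1 / K),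
          Real.mul_rpow (by positivity) (abs_nonneg _), Real.div_rpow zero_le_one hK.le,
          Real.one_rpow, ← neg_mul] at this
        calc |Y ω| ^ q = K ^ q * (1 / K ^ q * |Y ω| ^ q) := by field_simp
          _ ≤ K ^ q * (q ^ q * (Real.exp (1 / K * Y ω) + Real.exp (-(1 / K) * Y ω))) := by gcongr
          _ = _ := by ring
    _ = ENNReal.ofReal (q ^ q * K ^ q) * ((∫⁻ ω in B, ENNReal.ofReal (Real.exp (1 / K * Y ω)) ∂P) +
          ∫⁻ ω in B, ENNReal.ofReal (Real.exp (-(1 / K) * Y ω)) ∂P) := by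
        rw [lintegral_const_mul' _ _ ENNReal.ofReal_ne_top, lintegral_add_left' (by fun_prop)]
    _ ≤ ENNReal.ofReal (q ^ q * K ^ q) *
          (ENNReal.ofReal (Real.exp 1) + ENNReal.ofReal (Real.exp 1)) := by gcongr
    _ = _ := by
        rw [← ENNReal.ofReal_add (Real.exp_pos _).le (Real.exp_pos _).le,
          ← ENNReal.ofReal_mul (by positivity)]
        congr 1
        ring

end IsItoIntegral

namespace IsItoIntegral

theorem lintegral_sq_le [IsProbabilityMeasure P] (hW : IsWhiteNoise 𝓕 P W)
    {H : ℝ → Ω → ℝ} {Y : Ω → ℝ} (h : IsItoIntegral 𝓕 P W H Y)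
    (hm : ∀ ω, Measurable fun s => H s ω) {K : ℝ} (hK : 0 < K)
    (hHK : ∀ ω, ∫⁻ s, ENNReal.ofReal (H s ω ^ 2) ≤ ENNReal.ofReal (K ^ 2)) :
    ∫⁻ ω, ENNReal.ofReal (Y ω ^ 2) ∂P ≤ ENNReal.ofReal (8 * Real.exp 1 * K ^ 2) := by
  have := h.setLIntegral_rpow_le hW hm MeasurableSet.univ hK (fun ω _ => hHK ω) two_pos
  simp only [Measure.restrict_univ, Real.rpow_two, sq_abs] at this
  refine this.trans (le_of_eq ?_)
  congr 1
  ring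

/-- One half of the Itô isometry for a deterministic integrand, up to a constant. -/
theorem lintegral_sq_integrand_le [IsProbabilityMeasure P] (hW : IsWhiteNoise 𝓕 P W)
    {H : ℝ → ℝ} (hH : Measurable H) (hfin : ∫⁻ s, ENNReal.ofReal (H s ^ 2) ≠ ∞)
    {Y : Ω → ℝ} (h : IsItoIntegral 𝓕 P W (fun s _ => H s) Y) :
    ∫⁻ s, ENNReal.ofReal (H s ^ 2) ≤ ENNReal.ofReal (4 * ∫ ω, Y ω ^ 2 ∂P) := by
  have hYm := h.aemeasurable hW
  have hYfin : ∫⁻ ω, ENNReal.ofReal (Y ω ^ 2) ∂P ≠ ∞ := by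
    set K := √((∫⁻ s, ENNReal.ofReal (H s ^ 2)).toReal + 1)
    have hK : 0 < K := Real.sqrt_pos.2 (by positivity)
    refine ne_top_of_le_ne_top ENNReal.ofReal_ne_top
      (h.lintegral_sq_le hW (fun _ => hH) hK fun _ => ?_)
    rw [Real.sq_sqrt (by positivity)]
    conv_lhs => rw [← ENNReal.ofReal_toReal hfin]
    exact ENNReal.ofReal_le_ofReal (by linarith)
  have hYint : ENNReal.ofReal (∫ ω, Y ω ^ 2 ∂P) = ∫⁻ ω, ENNReal.ofReal (Y ω ^ 2) ∂P := by
    rw [integral_eq_lintegral_of_nonneg_ae (.of_forall fun ω => sq_nonneg _)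
      (hYm.pow_const 2).aestronglyMeasurable, ENNReal.ofReal_toReal hYfin]
  rw [ENNReal.ofReal_mul (by norm_num), hYint, ENNReal.ofReal_ofNat]
  refine ENNReal.le_of_forall_pos_le_add fun ε hε _ => ?_
  -- η is solved for so that the two approximation errors add up to exactly ε.
  obtain ⟨η, hη, hηε⟩ : ∃ η : ℝ, 0 < η ∧ 2 * η ^ 2 + 4 * (8 * Real.exp 1 * η ^ 2) = ε := by
    refine ⟨√(ε / (2 + 32 * Real.exp 1)), Real.sqrt_pos.2 (by positivity), ?_⟩
    rw [Real.sq_sqrt (by positivity)]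
    field_simp
    ring
  -- The approximants may be random although H is not. Some sample point has a path close to H;
  -- freezing the coefficients there gives a deterministic integrand obeying the exact isometry.
  obtain ⟨S, hS⟩ : ∃ S : SimpleIntegrand 𝓕, ∃ ω₀ : Ω,
      ∫⁻ s, ENNReal.ofReal ((S.eval s ω₀ - H s) ^ 2) < ENNReal.ofReal (η ^ 2) := by
    obtain ⟨S, hS, -⟩ := h
    have := (hS (ENNReal.ofReal (η ^ 2)) (by positivity)).eventually (gt_mem_nhds zero_lt_one)
    obtain ⟨n, hn⟩ := this.exists
    refine ⟨S n, ?_⟩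
    by_contra! hcon
    have huniv : {ω | ENNReal.ofReal (η ^ 2) ≤
        ∫⁻ s, ENNReal.ofReal (((S n).eval s ω - H s) ^ 2)} = univ := eq_univ_of_forall hcon
    rw [huniv, measure_univ] at hn
    exact lt_irrefl _ hn
  obtain ⟨ω₀, hS⟩ := hS
  set I := (S.freeze ω₀).integral W with hI
  have hdiff : IsItoIntegral 𝓕 P W (fun s _ => S.eval s ω₀ + (-1) * H s)
      (fun ω => I ω + (-1) * Y ω) :=
    add hW (of_simpleIntegrand (S.freeze ω₀)) (h.const_mul (-1)) fun ω => S.measurable_eval ω₀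
  have hdist := hdiff.lintegral_sq_le hW
    (fun _ => (S.measurable_eval ω₀).add (hH.const_mul _)) hη fun _ => by
      refine le_trans (le_of_eq ?_) hS.le
      refine lintegral_congr fun s => ?_
      ring_nf
  have hIm : Measurable I := (S.freeze ω₀).measurable_integral hW
  have hIint : ENNReal.ofReal (S.energy ω₀) = ∫⁻ ω, ENNReal.ofReal (I ω ^ 2) ∂P := by
    rw [← S.integral_freeze_sq hW ω₀, ofReal_integral_eq_lintegral_ofReal]
    · refine (memLp_finsetSum' (μ := P) (p := 2) (Finset.range S.N)
        (f := fun i ω => S.ξ i ω₀ * W (Ioc (S.time i) (S.time (i + 1))) ω) fun i _ =>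
        (hW.hasGaussianLaw_Ioc _ _).memLp_two.const_mul _).integrable_sq.congr
          (.of_forall fun ω => ?_)
      simp [SimpleIntegrand.integral, SimpleIntegrand.freeze]
    · exact .of_forall fun ω => sq_nonneg _
  have h1 : ∫⁻ s, ENNReal.ofReal (H s ^ 2) ≤
      2 * (ENNReal.ofReal (η ^ 2) + ∫⁻ ω, ENNReal.ofReal (I ω ^ 2) ∂P) := by
    have := lintegral_ofReal_add_sq_le (f := fun s => H s - S.eval s ω₀)
      (g := fun s => S.eval s ω₀) (hH.sub (S.measurable_eval ω₀))
    simp only [sub_add_cancel] at this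
    rw [S.lintegral_eval_sq, hIint] at this
    refine this.trans (mul_le_mul_right (add_le_add (le_trans (le_of_eq ?_) hS.le) le_rfl) _)
    refine lintegral_congr fun s => ?_
    ring_nf
  have h2 : ∫⁻ ω, ENNReal.ofReal (I ω ^ 2) ∂P ≤
      2 * (ENNReal.ofReal (8 * Real.exp 1 * η ^ 2) + ∫⁻ ω, ENNReal.ofReal (Y ω ^ 2) ∂P) := by
    refine le_trans ?_ (mul_le_mul_right (add_le_add hdist le_rfl) _)
    rw [← lintegral_add_left' (by fun_prop), ← lintegral_const_mul' _ _ (by simp)]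
    refine lintegral_mono fun ω => ?_
    rw [← ENNReal.ofReal_add (sq_nonneg _) (sq_nonneg _), ← ENNReal.ofReal_ofNat 2,
      ← ENNReal.ofReal_mul (by norm_num)]
    exact ENNReal.ofReal_le_ofReal (by nlinarith [sq_nonneg (I ω + -1 * Y ω - Y ω)])
  -- Two triangle inequalities for squares, each costing a factor 2, give the constant 4.
  calc ∫⁻ s, ENNReal.ofReal (H s ^ 2)
      ≤ 2 * (ENNReal.ofReal (η ^ 2) + 2 * (ENNReal.ofReal (8 * Real.exp 1 * η ^ 2) +
          ∫⁻ ω, ENNReal.ofReal (Y ω ^ 2) ∂P)) := h1.trans (by gcongr)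
    _ = 4 * (∫⁻ ω, ENNReal.ofReal (Y ω ^ 2) ∂P) +
          (2 * ENNReal.ofReal (η ^ 2) + 4 * ENNReal.ofReal (8 * Real.exp 1 * η ^ 2)) := by ring
    _ = _ := by
        rw [← ENNReal.ofReal_ofNat 2, ← ENNReal.ofReal_ofNat 4,
          ← ENNReal.ofReal_mul (by norm_num : (0:ℝ) ≤ 2),
          ← ENNReal.ofReal_mul (by norm_num : (0:ℝ) ≤ 4), ← ENNReal.ofReal_add (by positivity)
          (by positivity), hηε, ENNReal.ofReal_coe_nnreal]

end IsItoIntegral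

/-! ### Càdlàg processes -/

theorem measurable_uncurry_of_cadlag {σ : ℝ → Ω → ℝ} (hm : ∀ t, Measurable (σ t))
    (hc : ∀ ω, IsCadlagFun fun t => σ t ω) : Measurable fun p : ℝ × Ω => σ p.1 p.2 := by
  -- Grid points to the right of s: each n involves countably many times, and right-continuity gives
  -- the limit.
  let r : ℕ → ℝ → ℝ := fun n s => ((⌊((n : ℝ) + 1) * s⌋ : ℝ) + 1) / ((n : ℝ) + 1)
  refine measurable_of_tendsto_metrizable (f := fun n (p : ℝ × Ω) => σ (r n p.1) p.2) ?_ ?_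
  · intro n
    have h1 : Measurable fun p : ℤ × Ω => σ (((p.1 : ℝ) + 1) / ((n : ℝ) + 1)) p.2 :=
      measurable_from_prod_countable_right fun z => hm (((z : ℝ) + 1) / ((n : ℝ) + 1))
    have h2 : Measurable fun p : ℝ × Ω => (⌊((n : ℝ) + 1) * p.1⌋, p.2) :=
      (Int.measurable_floor.comp (measurable_fst.const_mul _)).prodMk measurable_snd
    exact h1.comp h2
  · rw [tendsto_pi_nhds]
    rintro ⟨s, ω⟩
    have hpos : ∀ n : ℕ, (0 : ℝ) < (n : ℝ) + 1 := fun n => by positivity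
    have hge : ∀ n, s ≤ r n s := fun n => by
      rw [le_div_iff₀ (hpos n)]
      linarith [Int.lt_floor_add_one (((n : ℝ) + 1) * s)]
    have hle : ∀ n, r n s ≤ s + 1 / ((n : ℝ) + 1) := fun n => by
      have e : s + 1 / ((n : ℝ) + 1) = (((n : ℝ) + 1) * s + 1) / ((n : ℝ) + 1) := by field_simp
      rw [e, div_le_div_iff_of_pos_right (hpos n)]
      linarith [Int.floor_le (((n : ℝ) + 1) * s)]
    have hlim : Tendsto (fun n => r n s) atTop (𝓝 s) := by
      refine tendsto_of_tendsto_of_tendsto_of_le_of_le tendsto_const_nhds ?_ hge hle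
      simpa using tendsto_one_div_add_atTop_nhds_zero_nat.const_add s
    exact ((hc ω s).1.tendsto).comp (tendsto_nhdsWithin_iff.2 ⟨hlim, .of_forall hge⟩)

theorem IsCadlagFun.exists_bound {f : ℝ → ℝ} (hf : IsCadlagFun f) (a b : ℝ) :
    ∃ C, ∀ x ∈ Icc a b, |f x| ≤ C := by
  refine isCompact_Icc.induction_on (p := fun s => ∃ C, ∀ x ∈ s, |f x| ≤ C) ⟨0, by simp⟩ ?_ ?_ ?_
  · rintro s t hst ⟨C, hC⟩
    exact ⟨C, fun x hx => hC x (hst hx)⟩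
  · rintro s t ⟨C, hC⟩ ⟨D, hD⟩
    refine ⟨max C D, fun x hx => hx.elim (fun h => (hC x h).trans (le_max_left _ _))
      fun h => (hD x h).trans (le_max_right _ _)⟩
  · intro x _
    obtain ⟨hr, l, hl⟩ := hf x
    have h1 : ∀ᶠ y in 𝓝[≥] x, |f y| ≤ |f x| + 1 :=
      hr.tendsto.abs.eventually (eventually_le_nhds (by linarith))
    have h2 : ∀ᶠ y in 𝓝[<] x, |f y| ≤ |l| + 1 :=
      hl.abs.eventually (eventually_le_nhds (by linarith))
    have h3 : ∀ᶠ y in 𝓝 x, |f y| ≤ max (|f x| + 1) (|l| + 1) := by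
      rw [← nhdsLT_sup_nhdsGE, eventually_sup]
      exact ⟨h2.mono fun y hy => hy.trans (le_max_right _ _),
        h1.mono fun y hy => hy.trans (le_max_left _ _)⟩
    exact ⟨_, mem_nhdsWithin_of_mem_nhds h3, _, fun y hy => hy⟩

/-- The supremum of `|f|` on `[a, b]`, computed along countably many times. -/
noncomputable def supOn (a b : ℝ) (f : ℝ → ℝ) : ℝ≥0∞ :=
  ⨆ q : ℚ, ENNReal.ofReal |f (max a (min q b))|

theorem measurable_supOn {σ : ℝ → Ω → ℝ} (hm : ∀ t, Measurable (σ t)) (a b : ℝ) :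
    Measurable fun ω => supOn a b fun t => σ t ω :=
  Measurable.iSup fun _ => ENNReal.measurable_ofReal.comp (hm _).abs

theorem IsCadlagFun.supOn_lt_top {f : ℝ → ℝ} (hf : IsCadlagFun f) {a b : ℝ} (hab : a ≤ b) :
    supOn a b f < ∞ := by
  obtain ⟨C, hC⟩ := hf.exists_bound a b
  refine lt_of_le_of_lt (iSup_le fun q => ENNReal.ofReal_le_ofReal (hC _ ⟨le_max_left _ _, ?_⟩))
    (ENNReal.ofReal_lt_top (r := C))
  exact max_le hab (min_le_right _ _)

theorem IsCadlagFun.abs_le_of_supOn_le {f : ℝ → ℝ} (hf : IsCadlagFun f) {a b M : ℝ} (hM : 0 ≤ M)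
    (h : supOn a b f ≤ ENNReal.ofReal M) {x : ℝ} (hx : x ∈ Icc a b) : |f x| ≤ M := by
  have hq : ∀ q : ℚ, |f (max a (min q b))| ≤ M := fun q => by
    have := (le_iSup (fun q : ℚ => ENNReal.ofReal |f (max a (min q b))|) q).trans h
    exact (ENNReal.ofReal_le_ofReal_iff hM).1 this
  -- The right endpoint cannot be approached from its right inside the interval; it is reached
  -- through a larger rational clipped to it.
  rcases hx.2.eq_or_lt with rfl | hxb
  · obtain ⟨q, hq'⟩ := exists_rat_gt x
    have := hq q
    rwa [min_eq_right hq'.le, max_eq_right hx.1] at this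
  · by_contra! hlt
    have h1 : ∀ᶠ y in 𝓝[>] x, M < |f y| :=
      ((hf x).1.tendsto.mono_left (nhdsWithin_mono _ Ioi_subset_Ici_self)).abs.eventually
        (lt_mem_nhds hlt)
    obtain ⟨c, hc, hcs⟩ := (nhdsGT_basis x).eventually_iff.1 h1
    obtain ⟨q, hq1, hq2⟩ := exists_rat_btwn (lt_min hc hxb)
    have h2 := hq q
    rw [min_eq_left (hq2.trans_le (min_le_right _ _)).le, max_eq_right (hx.1.trans hq1.le)] at h2
    exact absurd h2 (not_le.2 (hcs ⟨hq1, hq2.trans_le (min_le_left _ _)⟩))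

/-- An almost surely finite random variable is bounded up to a small probability. -/
theorem exists_measure_lt_le [IsProbabilityMeasure P] {N : Ω → ℝ≥0∞} (hN : Measurable N)
    (hfin : ∀ᵐ ω ∂P, N ω < ∞) {ε : ℝ} (hε : 0 < ε) :
    ∃ M : ℝ, 1 ≤ M ∧ P {ω | ENNReal.ofReal M < N ω} ≤ ENNReal.ofReal ε := by
  have hlim := tendsto_measure_iInter_atTop (μ := P) (s := fun n : ℕ => {ω | (n : ℝ≥0∞) < N ω})
    (fun n => (measurableSet_lt measurable_const hN).nullMeasurableSet)
    (fun a b hab ω (hω : (b : ℝ≥0∞) < N ω) => lt_of_le_of_lt (by exact_mod_cast hab) hω)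
    ⟨0, measure_ne_top _ _⟩
  have h0 : P (⋂ n : ℕ, {ω | (n : ℝ≥0∞) < N ω}) = 0 := by
    refine measure_mono_null (fun ω hω => ?_) (ae_iff.1 hfin)
    intro hlt
    obtain ⟨n, hn⟩ := ENNReal.exists_nat_gt hlt.ne
    exact absurd (mem_iInter.1 hω n) (not_lt.2 hn.le)
  rw [h0] at hlim
  obtain ⟨n, hn, hn1⟩ := ((hlim.eventually (ge_mem_nhds (ENNReal.ofReal_pos.2 hε))).and
    (eventually_ge_atTop 1)).exists
  refine ⟨n, by exact_mod_cast hn1, ?_⟩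
  simpa using hn

variable {g : ℝ → ℝ} {k : ℕ}

/-! ### The kernel of a difference of a moving average -/

/-- The iterated difference of `g`, extended by `0` to `(-∞, 0]`. -/
noncomputable def diffKernel (g : ℝ → ℝ) (k : ℕ) (δ : ℝ) : ℝ → ℝ :=
  (fwdDiff δ)^[k] ((Ioi 0).indicator g)

theorem measurable_indicator_of_continuousOn (hg : ContinuousOn g (Ioi 0)) :
    Measurable ((Ioi 0).indicator g) := by
  classical
  rw [← piecewise_eq_indicator]
  exact hg.measurable_piecewise continuousOn_const measurableSet_Ioi

theorem measurable_diffKernel (hg : ContinuousOn g (Ioi 0)) (k : ℕ) (δ : ℝ) :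
    Measurable (diffKernel g k δ) := by
  have h : diffKernel g k δ = fun x => _ := funext fun x => fwdDiff_iter_eq_sum _ k δ x
  rw [h]
  exact Finset.measurable_fun_sum _ fun j _ =>
    ((measurable_indicator_of_continuousOn hg).comp (measurable_id.add_const _)).const_mul _

theorem sum_choose_indicator_eq_diffKernel (g : ℝ → ℝ) (k i : ℕ) (δ s : ℝ) :
    ∑ j ∈ Finset.range (k + 1), (-1 : ℝ) ^ j * (k.choose j : ℝ) *
      (Ioi 0).indicator g (((i : ℝ) - j) * δ - s) = diffKernel g k δ (((i : ℝ) - k) * δ - s) := by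
  have := sum_choose_eq_fwdDiff_iter ((Ioi 0).indicator g) k i δ (-s)
  simp only [← sub_eq_add_neg] at this
  exact this

theorem indicator_Iio_eq (g f : ℝ → ℝ) (t s : ℝ) :
    (Iio t).indicator (fun s => g (t - s) * f s) s = (Ioi 0).indicator g (t - s) * f s := by
  by_cases h : s < t
  · rw [indicator_of_mem (mem_Iio.2 h), indicator_of_mem (mem_Ioi.2 (sub_pos.2 h))]
  · rw [indicator_of_notMem (by simpa using h), indicator_of_notMem (by simpa using h), zero_mul]

theorem isItoIntegral_difference [IsProbabilityMeasure P] (hW : IsWhiteNoise 𝓕 P W)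
    (hg : ContinuousOn g (Ioi 0)) {σ X : ℝ → Ω → ℝ} (hσ : ∀ ω, Measurable fun s => σ s ω)
    (hX : IsMovingAverage 𝓕 P W g σ X) (k i : ℕ) (δ : ℝ) :
    IsItoIntegral 𝓕 P W (fun s ω => diffKernel g k δ (((i : ℝ) - k) * δ - s) * σ s ω)
      (difference X k 1 δ i) := by
  have h := IsItoIntegral.sum hW (Finset.range (k + 1)) (fun j _ =>
    (hX (((i : ℝ) - j) * δ)).const_mul ((-1 : ℝ) ^ j * (k.choose j : ℝ))) (fun j _ ω => by
      simp_rw [indicator_Iio_eq]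
      exact (((measurable_indicator_of_continuousOn hg).comp (measurable_const.sub
        measurable_id)).mul (hσ ω)).const_mul _)
  convert h using 2
  · ext ω
    simp_rw [indicator_Iio_eq, ← mul_assoc]
    rw [← Finset.sum_mul, sum_choose_indicator_eq_diffKernel]
  · exact difference_one_eq X k i δ _

theorem sum_choose_mul_sq_le (k : ℕ) (f : ℕ → ℝ) :
    (∑ j ∈ Finset.range (k + 1), (-1 : ℝ) ^ j * (k.choose j : ℝ) * f j) ^ 2 ≤
      ((k : ℝ) + 1) * 4 ^ k * ∑ j ∈ Finset.range (k + 1), f j ^ 2 := by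
  have h1 := sq_sum_le_card_mul_sum_sq (s := Finset.range (k + 1))
    (f := fun j => (-1 : ℝ) ^ j * (k.choose j : ℝ) * f j)
  rw [Finset.card_range] at h1
  push_cast at h1
  refine h1.trans ?_
  rw [mul_assoc]
  refine mul_le_mul_of_nonneg_left ?_ (by positivity)
  rw [Finset.mul_sum]
  refine Finset.sum_le_sum fun j _ => ?_
  rw [mul_pow, mul_pow, ← pow_mul, mul_comm j 2, pow_mul, neg_one_sq, one_pow, one_mul]
  gcongr
  have h2 : (k.choose j : ℝ) ≤ 2 ^ k := by exact_mod_cast Nat.choose_le_two_pow k j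
  calc (k.choose j : ℝ) ^ 2 ≤ (2 ^ k) ^ 2 := by gcongr
    _ = 4 ^ k := by rw [← pow_mul, mul_comm, pow_mul]; norm_num

theorem lintegral_diffKernel_mul_sq_lt_top (hg : ContinuousOn g (Ioi 0)) {f : ℝ → ℝ}
    (hf : Measurable f) (k i : ℕ) (δ : ℝ)
    (hfin : ∀ j ≤ k, ∫⁻ s in Iio (((i : ℝ) - j) * δ),
      ENNReal.ofReal (g (((i : ℝ) - j) * δ - s) ^ 2 * f s ^ 2) < ∞) :
    ∫⁻ s, ENNReal.ofReal ((diffKernel g k δ (((i : ℝ) - k) * δ - s) * f s) ^ 2) < ∞ := by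
  have hmeas : ∀ j : ℕ, Measurable fun s =>
      ENNReal.ofReal (((Ioi 0).indicator g (((i : ℝ) - j) * δ - s) * f s) ^ 2) := fun j =>
    ENNReal.measurable_ofReal.comp ((((measurable_indicator_of_continuousOn hg).comp
      (measurable_const.sub measurable_id)).mul hf).pow_const 2)
  calc _ ≤ ∫⁻ s, ENNReal.ofReal (((k : ℝ) + 1) * 4 ^ k) * ∑ j ∈ Finset.range (k + 1),
        ENNReal.ofReal (((Ioi 0).indicator g (((i : ℝ) - j) * δ - s) * f s) ^ 2) := by
        refine lintegral_mono fun s => ?_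
        rw [← ENNReal.ofReal_sum_of_nonneg fun _ _ => sq_nonneg _,
          ← ENNReal.ofReal_mul (by positivity), ← sum_choose_indicator_eq_diffKernel,
          Finset.sum_mul]
        refine ENNReal.ofReal_le_ofReal ?_
        simpa only [mul_assoc] using sum_choose_mul_sq_le k
          fun j => (Ioi 0).indicator g (((i : ℝ) - j) * δ - s) * f s
    _ < ∞ := by
        rw [lintegral_const_mul' _ _ ENNReal.ofReal_ne_top,
          lintegral_finsetSum _ fun j _ => hmeas j]
        refine ENNReal.mul_lt_top ENNReal.ofReal_lt_top (ENNReal.sum_lt_top.2 fun j hj => ?_)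
        have hj' : j ≤ k := by simpa [Nat.lt_succ_iff] using hj
        refine lt_of_le_of_lt (le_of_eq ?_) (hfin j hj')
        rw [← lintegral_indicator measurableSet_Iio]
        refine lintegral_congr fun s => ?_
        by_cases h : s < ((i : ℝ) - j) * δ
        · rw [indicator_of_mem (mem_Iio.2 h), indicator_of_mem (mem_Ioi.2 (sub_pos.2 h)), mul_pow]
        · rw [indicator_of_notMem (by simpa using h), indicator_of_notMem (by simpa using h)]
          simp

/-- This is the stationarity that lets a single `tau` serve every stage i. -/
theorem lintegral_diffKernel_translate (g : ℝ → ℝ) (k : ℕ) (δ c : ℝ) :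
    ∫⁻ s, ENNReal.ofReal (diffKernel g k δ (c - s) ^ 2) =
      ∫⁻ s, ENNReal.ofReal (diffKernel g k δ s ^ 2) :=
  lintegral_sub_left_eq_self (fun s => ENNReal.ofReal (diffKernel g k δ s ^ 2)) c

theorem lintegral_diffKernel_sq_lt_top (hgc : ContinuousOn g (Ioi 0))
    (hg : MemLp g 2 (volume.restrict (Ioi 0))) (k : ℕ) (δ : ℝ) :
    ∫⁻ s, ENNReal.ofReal (diffKernel g k δ s ^ 2) < ∞ := by
  have hg2 : ∫⁻ s in Ioi 0, ENNReal.ofReal (g s ^ 2) < ∞ := by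
    have := hg.integrable_sq.hasFiniteIntegral
    rwa [hasFiniteIntegral_iff_ofReal (.of_forall fun _ => sq_nonneg _)] at this
  have h := lintegral_diffKernel_mul_sq_lt_top hgc (f := fun _ => 1) measurable_const k 0 δ
    fun j _ => by
      refine lt_of_le_of_lt (le_of_eq ?_) hg2
      rw [← lintegral_indicator measurableSet_Iio, ← lintegral_indicator measurableSet_Ioi,
        ← lintegral_sub_left_eq_self _ ((((0 : ℕ) : ℝ) - j) * δ)]
      refine lintegral_congr fun s => ?_
      simp only [indicator, mem_Iio, mem_Ioi, sub_lt_self_iff, sub_sub_cancel, one_pow, mul_one]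
  simp only [mul_one] at h
  rwa [lintegral_diffKernel_translate] at h

theorem diffKernel_eq_zero {δ x : ℝ} (hδ : 0 ≤ δ) (hx : x + k * δ ≤ 0) :
    diffKernel g k δ x = 0 := by
  rw [diffKernel, fwdDiff_iter_eq_sum]
  refine Finset.sum_eq_zero fun j _ => ?_
  have : (0 : ℝ) ≤ j * δ := by positivity
  rw [indicator_of_notMem (by rw [mem_Ioi, not_lt]; linarith), mul_zero]

/-- Within δ of the latest time every older summand is evaluated on (-∞, 0] and vanishes, leaving g
alone. -/
theorem setLIntegral_sq_le_lintegral_diffKernel {δ : ℝ} (hδ : 0 < δ) :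
    ∫⁻ s in Ioc 0 δ, ENNReal.ofReal (g s ^ 2) ≤
      ∫⁻ s, ENNReal.ofReal (diffKernel g k δ s ^ 2) := by
  rw [← lintegral_sub_right_eq_self (fun s => ENNReal.ofReal (diffKernel g k δ s ^ 2)) (k * δ)]
  refine le_trans (le_of_eq ?_) (setLIntegral_le_lintegral (Ioc 0 δ) _)
  refine setLIntegral_congr_fun measurableSet_Ioc fun s hs => ?_
  have h : diffKernel g k δ (s - k * δ) = g s := by
    rw [diffKernel, fwdDiff_iter_eq_sum, Finset.sum_eq_single_of_mem 0 (by simp)]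
    · have e : s - k * δ + ((k : ℝ) - (0 : ℕ)) * δ = s := by push_cast; ring
      rw [e, indicator_of_mem (mem_Ioi.2 hs.1)]
      simp
    · intro j _ hj
      have h1 : (1 : ℝ) ≤ j := by exact_mod_cast Nat.one_le_iff_ne_zero.2 hj
      rw [indicator_of_notMem, mul_zero]
      rw [mem_Ioi, not_lt]
      nlinarith [hs.2]
  simp only [h]

theorem lintegral_diffKernel_sq_le_tau [IsProbabilityMeasure P] (hW : IsWhiteNoise 𝓕 P W)
    (hgc : ContinuousOn g (Ioi 0)) (hg : MemLp g 2 (volume.restrict (Ioi 0))) {G : ℝ → Ω → ℝ}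
    (hG : IsGaussianCore 𝓕 P W g G) (k : ℕ) (δ : ℝ) :
    ∫⁻ s, ENNReal.ofReal (diffKernel g k δ s ^ 2) ≤ ENNReal.ofReal (4 * tau P G k δ ^ 2) := by
  have h := isItoIntegral_difference hW hgc (fun _ => measurable_const) hG k k δ
  simp only [mul_one] at h
  rw [tau, Real.sq_sqrt (integral_nonneg fun _ => sq_nonneg _),
    ← lintegral_diffKernel_translate g k δ (((k : ℝ) - k) * δ)]
  refine h.lintegral_sq_integrand_le hW
    ((measurable_diffKernel hgc k δ).comp (measurable_const.sub measurable_id)) ?_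
  have h2 := lintegral_diffKernel_translate g k δ (((k : ℝ) - k) * δ)
  exact (h2.trans_lt (lintegral_diffKernel_sq_lt_top hgc hg k δ)).ne

theorem exists_diffKernel_eq (hg : ContDiffOn ℝ k g (Ioi 0)) {δ x : ℝ} (hδ : 0 < δ) (hx : 0 < x) :
    ∃ ξ, x ≤ ξ ∧ ξ ≤ x + k * δ ∧ diffKernel g k δ x = δ ^ k * iteratedDeriv k g ξ := by
  have hkδ : (0 : ℝ) ≤ k * δ := by positivity
  obtain ⟨ξ, hξ, h⟩ := exists_fwdDiff_iter_eq (a := x) hδ k (fun j => iteratedDeriv j g)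
    (x + k * δ) (fun j hj y hy => by
      have hy0 : 0 < y := hx.trans_le hy.1
      rw [iteratedDeriv_succ]
      refine (DifferentiableAt.hasDerivAt ?_).hasDerivWithinAt
      have h1 := hg.differentiableOn_iteratedDerivWithin (by exact_mod_cast hj)
        (uniqueDiffOn_Ioi 0)
      refine (h1.differentiableAt (Ioi_mem_nhds hy0)).congr_of_eventuallyEq ?_
      filter_upwards [Ioi_mem_nhds hy0] with z hz
      exact (iteratedDerivWithin_of_isOpen isOpen_Ioi hz).symm) x le_rfl le_rfl
  refine ⟨ξ, hξ.1, hξ.2, ?_⟩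
  rw [iteratedDeriv_zero] at h
  rw [← h, diffKernel, fwdDiff_iter_eq_sum, fwdDiff_iter_eq_sum]
  refine Finset.sum_congr rfl fun j hj => ?_
  have hj' : (j : ℝ) ≤ k := by
    exact_mod_cast (by simpa [Nat.lt_succ_iff] using hj : j ≤ k)
  have : 0 ≤ ((k : ℝ) - j) * δ := mul_nonneg (by linarith) hδ.le
  rw [indicator_of_mem (by rw [mem_Ioi]; linarith)]

/-- Far from the origin, the differences with a small step are controlled by those with step `1`. -/
theorem abs_diffKernel_le (hg : ContDiffOn ℝ k g (Ioi 0)) {a : ℝ} (ha : 0 < a)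
    (hanti : AntitoneOn (fun x => |iteratedDeriv k g x|) (Ioi a)) {δ x y : ℝ} (hδ : 0 < δ)
    (hy : a + k < y) (hyx : y ≤ x) : |diffKernel g k δ x| ≤ δ ^ k * |diffKernel g k 1 (y - k)| := by
  have hk : (0 : ℝ) ≤ k := k.cast_nonneg
  obtain ⟨ξ, h1, -, h⟩ := exists_diffKernel_eq hg hδ (x := x) (by linarith)
  -- Starting the unit-step difference at y - k forces η ≤ y ≤ x ≤ ξ while η still exceeds a, so
  -- monotonicity applies.
  obtain ⟨η, h2, h3, h'⟩ := exists_diffKernel_eq hg one_pos (x := y - k) (by linarith)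
  rw [h, h', one_pow, one_mul, abs_mul, abs_of_pos (pow_pos hδ k)]
  exact mul_le_mul_of_nonneg_left (hanti (a := η) (b := ξ) (by rw [mem_Ioi]; linarith)
    (by rw [mem_Ioi]; linarith) (by linarith)) (pow_pos hδ k).le

/-- Cut at -(a + k). Later, f is bounded until T and the kernel vanishes beyond T; earlier, the
kernel is at most δ^k times that of one fixed unit-step difference, whose energy depends on neither
δ nor c. -/
theorem lintegral_diffKernel_mul_sq_le (hg : ContDiffOn ℝ k g (Ioi 0)) {a : ℝ} (ha : 0 < a)
    (hanti : AntitoneOn (fun x => |iteratedDeriv k g x|) (Ioi a)) {δ c T M : ℝ} (hδ : 0 < δ)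
    (hc : 0 ≤ c) (hcT : c + k * δ ≤ T) {f : ℝ → ℝ} (hM : ∀ s ∈ Icc (-(a + k)) T, |f s| ≤ M) :
    ∫⁻ s, ENNReal.ofReal ((diffKernel g k δ (c - s) * f s) ^ 2) ≤
      ENNReal.ofReal (M ^ 2) * (∫⁻ s, ENNReal.ofReal (diffKernel g k δ s ^ 2)) +
      ENNReal.ofReal ((δ ^ k) ^ 2) *
        ∫⁻ s, ENNReal.ofReal ((diffKernel g k 1 (-k - s) * f s) ^ 2) := by
  rw [← lintegral_diffKernel_translate g k δ c, ← lintegral_const_mul' _ _ ENNReal.ofReal_ne_top,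
    ← lintegral_const_mul' _ _ ENNReal.ofReal_ne_top, ← lintegral_add_left]
  · refine lintegral_mono fun s => ?_
    rw [← ENNReal.ofReal_mul (sq_nonneg _), ← ENNReal.ofReal_mul (sq_nonneg _),
      ← ENNReal.ofReal_add (by positivity) (by positivity)]
    refine ENNReal.ofReal_le_ofReal ?_
    rcases lt_or_ge s (-(a + k)) with hs | hs
    · have h := abs_diffKernel_le hg ha hanti hδ (x := c - s) (y := -s) (by linarith) (by linarith)
      rw [show -s - (k : ℝ) = -k - s by ring] at h
      have h2 : diffKernel g k δ (c - s) ^ 2 ≤ (δ ^ k * |diffKernel g k 1 (-k - s)|) ^ 2 := by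
        rw [← sq_abs (diffKernel g k δ (c - s))]
        gcongr
      rw [mul_pow, sq_abs] at h2
      rw [mul_pow, mul_pow]
      have := mul_le_mul_of_nonneg_right h2 (sq_nonneg (f s))
      have h3 : 0 ≤ M ^ 2 * diffKernel g k δ (c - s) ^ 2 := by positivity
      linarith
    · have h3 : 0 ≤ (δ ^ k) ^ 2 * (diffKernel g k 1 (-k - s) * f s) ^ 2 := by positivity
      refine le_trans ?_ (le_add_of_nonneg_right h3)
      rcases le_or_gt s T with hsT | hsT
      · have h4 : f s ^ 2 ≤ M ^ 2 := by
          rw [← sq_abs (f s)]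
          exact pow_le_pow_left₀ (abs_nonneg _) (hM s ⟨hs, hsT⟩) 2
        rw [mul_pow, mul_comm]
        gcongr
      · rw [diffKernel_eq_zero hδ.le (by linarith)]
        simp
  · exact (ENNReal.measurable_ofReal.comp (((measurable_diffKernel hg.continuousOn k δ).comp
      (measurable_const.sub measurable_id)).pow_const 2)).const_mul _

theorem exists_le_tau [IsProbabilityMeasure P] (hW : IsWhiteNoise 𝓕 P W)
    (hgc : ContinuousOn g (Ioi 0)) (hg : MemLp g 2 (volume.restrict (Ioi 0))) {G : ℝ → Ω → ℝ}
    (hG : IsGaussianCore 𝓕 P W g G) (k : ℕ) {L : ℝ → ℝ} {α : ℝ} (hL : SlowlyVaryingAtZero L)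
    (hpos : ∀ x, 0 < x → 0 < L x) (hgL : ∀ᶠ x in 𝓝[>] (0 : ℝ), |g x| = x ^ α * L x)
    (hα : α < 1 / 2) :
    ∃ c > 0, ∀ᶠ δ in 𝓝[>] (0 : ℝ), c * (δ ^ (α + 1 / 2) * L δ) ≤ tau P G k δ := by
  obtain ⟨c, hc, h⟩ := exists_le_lintegral_sq hL hpos hgL hα
  -- The 2 is the square root of the isometry constant 4.
  refine ⟨√c / 2, by positivity, ?_⟩
  filter_upwards [h, self_mem_nhdsWithin] with δ hδ hδ0
  have h1 := (hδ.trans (setLIntegral_sq_le_lintegral_diffKernel (k := k) hδ0)).trans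
    (lintegral_diffKernel_sq_le_tau hW hgc hg hG k δ)
  rw [ENNReal.ofReal_le_ofReal_iff (by positivity)] at h1
  have hδ0' : (0 : ℝ) < δ := hδ0
  have hLδ := hpos δ hδ0
  refine (pow_le_pow_iff_left₀ (by positivity) (Real.sqrt_nonneg _) two_ne_zero).1 ?_
  change _ ≤ tau P G k δ ^ 2
  rw [mul_pow, div_pow, Real.sq_sqrt hc.le]
  linarith

/-! ### Tightness of the normalized power variation -/

theorem normalizedPowerVariation_one (P : Measure Ω) (G Y : ℝ → Ω → ℝ) (p : ℝ) (k : ℕ)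
    (δ t : ℝ) (ω : Ω) :
    normalizedPowerVariation P G Y p k 1 δ t ω = δ * tau P G k δ ^ (-p) *
      ∑ i ∈ Finset.Icc k ⌊t / δ⌋₊, |difference Y k 1 δ i ω| ^ p := by
  simp [normalizedPowerVariation, powerVariation]

theorem card_Icc_floor_le (hk : 1 ≤ k) {x : ℝ} (hx : 0 ≤ x) :
    ((Finset.Icc k ⌊x⌋₊).card : ℝ) ≤ x := by
  refine le_trans ?_ (Nat.floor_le hx)
  rw [Nat.card_Icc]
  exact_mod_cast (by omega : ⌊x⌋₊ + 1 - k ≤ ⌊x⌋₊)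

/-- Both bounds are read off one measurable, almost surely finite variable N, a sublevel set of
which is B. The energy F is finite because `hfinite` holds at the times 0, -1, …, -k. -/
theorem exists_measurableSet_bounded [IsProbabilityMeasure P] (hgc : ContinuousOn g (Ioi 0))
    {σ : ℝ → Ω → ℝ} (hσ : ∀ t, Measurable (σ t)) (hσc : ∀ ω, IsCadlagFun fun t => σ t ω)
    (hfinite : ∀ t : ℝ, ∀ᵐ ω ∂P,
      ∫⁻ s in Iio t, ENNReal.ofReal (g (t - s) ^ 2 * σ s ω ^ 2) < ∞)
    (k : ℕ) {a b : ℝ} (hab : a ≤ b) {ε : ℝ} (hε : 0 < ε) :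
    ∃ B : Set Ω, MeasurableSet B ∧ P Bᶜ ≤ ENNReal.ofReal ε ∧ ∃ M : ℝ, 1 ≤ M ∧
      ∀ ω ∈ B, (∀ s ∈ Icc a b, |σ s ω| ≤ M) ∧
        ∫⁻ s, ENNReal.ofReal ((diffKernel g k 1 (-k - s) * σ s ω) ^ 2) ≤ ENNReal.ofReal M := by
  have hjoint := measurable_uncurry_of_cadlag hσ hσc
  have hσs : ∀ ω, Measurable fun s => σ s ω := fun ω => hjoint.comp measurable_prodMk_right
  set F : Ω → ℝ≥0∞ := fun ω => ∫⁻ s, ENNReal.ofReal ((diffKernel g k 1 (-k - s) * σ s ω) ^ 2)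
  have hFm : Measurable F := by
    refine Measurable.lintegral_prod_left'
      (f := fun p : ℝ × Ω => ENNReal.ofReal ((diffKernel g k 1 (-k - p.1) * σ p.1 p.2) ^ 2)) ?_
    exact ENNReal.measurable_ofReal.comp ((((measurable_diffKernel hgc k 1).comp
      (measurable_const.sub measurable_fst)).mul hjoint).pow_const 2)
  have hFfin : ∀ᵐ ω ∂P, F ω < ∞ := by
    have hall : ∀ᵐ ω ∂P, ∀ j : ℕ, ∫⁻ s in Iio ((((0 : ℕ) : ℝ) - j) * 1),
        ENNReal.ofReal (g ((((0 : ℕ) : ℝ) - j) * 1 - s) ^ 2 * σ s ω ^ 2) < ∞ :=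
      ae_all_iff.2 fun j => hfinite _
    filter_upwards [hall] with ω hω
    have := lintegral_diffKernel_mul_sq_lt_top hgc (hσs ω) k 0 1 fun j _ => hω j
    simpa [F] using this
  set N : Ω → ℝ≥0∞ := fun ω => supOn a b (fun t => σ t ω) + F ω
  have hN : Measurable N := (measurable_supOn hσ a b).add hFm
  obtain ⟨M, hM, hPM⟩ := exists_measure_lt_le (P := P) hN (by
    filter_upwards [hFfin] with ω hω
    exact ENNReal.add_lt_top.2 ⟨(hσc ω).supOn_lt_top hab, hω⟩) hε
  refine ⟨{ω | N ω ≤ ENNReal.ofReal M}, measurableSet_le hN measurable_const, ?_, M, hM,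
    fun ω hω => ⟨fun s hs => ?_, ?_⟩⟩
  · simpa only [compl_ofPred, not_le] using hPM
  · exact (hσc ω).abs_le_of_supOn_le (by linarith) (le_self_add.trans hω) hs
  · exact le_add_self.trans hω

theorem isBigOP_normalizedPowerVariation [IsProbabilityMeasure P] (hW : IsWhiteNoise 𝓕 P W)
    (hg : MemLp g 2 (volume.restrict (Ioi 0))) (hgd : ContDiffOn ℝ k g (Ioi 0))
    (hanti : ∃ a : ℝ, 0 < a ∧ AntitoneOn (fun x => |iteratedDeriv k g x|) (Ioi a))
    {σ : ℝ → Ω → ℝ} (hσ : ∀ t, Measurable (σ t)) (hσc : ∀ ω, IsCadlagFun fun t => σ t ω)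
    (hfinite : ∀ t : ℝ, ∀ᵐ ω ∂P,
      ∫⁻ s in Iio t, ENNReal.ofReal (g (t - s) ^ 2 * σ s ω ^ 2) < ∞)
    {X : ℝ → Ω → ℝ} (hX : IsMovingAverage 𝓕 P W g σ X)
    {G : ℝ → Ω → ℝ} (hG : IsGaussianCore 𝓕 P W g G) (hk : 1 ≤ k)
    {Δ : ℕ → ℝ} (hΔ : ∀ n, 0 < Δ n) (hτ : ∀ᶠ n in atTop, Δ n ^ k ≤ tau P G k (Δ n))
    {t : ℝ} (ht : 0 ≤ t) {q : ℝ} (hq : 0 < q) :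
    IsBigOP P (fun n ω => normalizedPowerVariation P G X q k 1 (Δ n) t ω) fun _ => 1 := by
  intro ε hε
  have hgc := hgd.continuousOn
  have hσs : ∀ ω, Measurable fun s => σ s ω := fun ω =>
    (measurable_uncurry_of_cadlag hσ hσc).comp measurable_prodMk_right
  obtain ⟨a, ha, hanti⟩ := hanti
  obtain ⟨B, hB, hPB, M, hM, hBM⟩ := exists_measurableSet_bounded hgc hσ hσc hfinite k
    (a := -(a + k)) (b := t) (by have := k.cast_nonneg (α := ℝ); linarith) (half_pos hε)
  -- The factor 3M arises from 4M²τ² + Mτ² ≤ (3Mτ)², valid for M ≥ 1.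
  set Cq := 2 * Real.exp 1 * q ^ q * (3 * M) ^ q
  have hCq : 0 < Cq := by positivity
  set D := t * Cq
  have hD : 0 ≤ D := by positivity
  have hM' : 0 < 2 * (D + 1) / ε := by positivity
  -- The threshold for Markov's inequality; D + 1 keeps it positive when t = 0.
  refine ⟨2 * (D + 1) / ε, hM', ?_⟩
  filter_upwards [hτ] with n hn
  set δ := Δ n
  have hδ : 0 < δ := hΔ n
  set τ := tau P G k δ
  have hτ0 : 0 < τ := (pow_pos hδ k).trans_le hn
  have hY := fun i : ℕ => isItoIntegral_difference hW hgc hσs hX k i δ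
  have hmom : ∀ i ∈ Finset.Icc k ⌊t / δ⌋₊,
      ∫⁻ ω in B, ENNReal.ofReal (|difference X k 1 δ i ω| ^ q) ∂P ≤
        ENNReal.ofReal (Cq * τ ^ q) := by
    intro i hi
    rw [Finset.mem_Icc] at hi
    have hki : (k : ℝ) ≤ i := by exact_mod_cast hi.1
    have hit : (i : ℝ) * δ ≤ t := by
      rw [← le_div_iff₀ hδ]
      exact (Nat.le_floor_iff (by positivity)).1 hi.2
    have h := (hY i).setLIntegral_rpow_le hW
      (fun ω => (((measurable_diffKernel hgc k δ).comp
        (measurable_const.sub measurable_id)).mul (hσs ω))) hB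
      (K := 3 * M * τ) (by positivity) (fun ω hω => ?_) hq
    · refine h.trans (le_of_eq ?_)
      rw [Real.mul_rpow (by positivity) hτ0.le]
      congr 1
      ring
    · have h1 := lintegral_diffKernel_mul_sq_le hgd ha hanti hδ (c := ((i : ℝ) - k) * δ) (T := t)
        (mul_nonneg (by linarith) hδ.le) (by linarith) (hBM ω hω).1
      have h2 := lintegral_diffKernel_sq_le_tau hW hgc hg hG k δ
      calc _ ≤ _ := h1
        _ ≤ ENNReal.ofReal (M ^ 2) * ENNReal.ofReal (4 * τ ^ 2) +
              ENNReal.ofReal (τ ^ 2) * ENNReal.ofReal M := by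
            gcongr
            exact (hBM ω hω).2
        _ = ENNReal.ofReal (M ^ 2 * (4 * τ ^ 2) + τ ^ 2 * M) := by
            rw [← ENNReal.ofReal_mul (by positivity), ← ENNReal.ofReal_mul (by positivity),
              ← ENNReal.ofReal_add (by positivity) (by positivity)]
        _ ≤ _ := by
            refine ENNReal.ofReal_le_ofReal ?_
            have : M ≤ M ^ 2 := by nlinarith
            nlinarith [mul_le_mul_of_nonneg_left this (sq_nonneg τ), sq_nonneg (M * τ)]
  set V : Ω → ℝ := fun ω => normalizedPowerVariation P G X q k 1 δ t ω with hV
  have hVeq : ∀ ω, ENNReal.ofReal (V ω) = ENNReal.ofReal (δ * τ ^ (-q)) *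
      ∑ i ∈ Finset.Icc k ⌊t / δ⌋₊, ENNReal.ofReal (|difference X k 1 δ i ω| ^ q) := fun ω => by
    rw [hV]
    simp only
    rw [normalizedPowerVariation_one, ENNReal.ofReal_mul (by positivity),
      ENNReal.ofReal_sum_of_nonneg fun _ _ => by positivity]
  have hV0 : ∀ ω, 0 ≤ V ω := fun ω => by
    rw [hV]
    simp only
    rw [normalizedPowerVariation_one]
    positivity
  have hm : ∀ i, AEMeasurable (fun ω => ENNReal.ofReal (|difference X k 1 δ i ω| ^ q)) P :=
    fun i => ((((hY i).aemeasurable hW).abs).pow_const q).ennreal_ofReal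
  have hVm : AEMeasurable (fun ω => ENNReal.ofReal (V ω)) P := by
    simp_rw [hVeq]
    exact (Finset.aemeasurable_fun_sum _ fun i _ => hm i).const_mul _
  have hVint : ∫⁻ ω in B, ENNReal.ofReal (V ω) ∂P ≤ ENNReal.ofReal D := by
    simp_rw [hVeq]
    rw [lintegral_const_mul' _ _ ENNReal.ofReal_ne_top,
      lintegral_finsetSum' _ fun i _ => (hm i).restrict]
    calc _ ≤ ENNReal.ofReal (δ * τ ^ (-q)) *
          ∑ i ∈ Finset.Icc k ⌊t / δ⌋₊, ENNReal.ofReal (Cq * τ ^ q) :=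
          mul_le_mul_right (Finset.sum_le_sum hmom) _
      _ = ENNReal.ofReal (δ * τ ^ (-q) * ((Finset.Icc k ⌊t / δ⌋₊).card * (Cq * τ ^ q))) := by
          rw [Finset.sum_const, nsmul_eq_mul, ← ENNReal.ofReal_natCast,
            ← ENNReal.ofReal_mul (by positivity), ← ENNReal.ofReal_mul (by positivity)]
      _ ≤ _ := by
          refine ENNReal.ofReal_le_ofReal ?_
          calc δ * τ ^ (-q) * ((Finset.Icc k ⌊t / δ⌋₊).card * (Cq * τ ^ q))
              ≤ δ * τ ^ (-q) * (t / δ * (Cq * τ ^ q)) := by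
                gcongr
                exact card_Icc_floor_le hk (by positivity)
            _ = (τ ^ (-q) * τ ^ q) * (t * Cq) := by field_simp
            _ = D := by rw [← Real.rpow_add hτ0]; simp [D]
  have hmarkov := meas_ge_le_lintegral_div (μ := P.restrict B) hVm.restrict
    (ε := ENNReal.ofReal (2 * (D + 1) / ε)) (by positivity) ENNReal.ofReal_ne_top
  rw [Measure.restrict_apply' hB] at hmarkov
  calc P {ω | 2 * (D + 1) / ε * 1 < |V ω|}
      ≤ P ({ω | ENNReal.ofReal (2 * (D + 1) / ε) ≤ ENNReal.ofReal (V ω)} ∩ B ∪ Bᶜ) := by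
        refine measure_mono fun ω hω => ?_
        have hω : 2 * (D + 1) / ε * 1 < |V ω| := hω
        by_cases hωB : ω ∈ B
        · refine Or.inl ⟨ENNReal.ofReal_le_ofReal ?_, hωB⟩
          rw [mul_one, abs_of_nonneg (hV0 ω)] at hω
          exact hω.le
        · exact Or.inr hωB
    _ ≤ _ := measure_union_le _ _
    _ ≤ ENNReal.ofReal (ε / 2) + ENNReal.ofReal (ε / 2) := by
        refine add_le_add (hmarkov.trans ?_) hPB
        refine (ENNReal.div_le_div_right hVint _).trans ?_
        rw [← ENNReal.ofReal_div_of_pos hM']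
        refine ENNReal.ofReal_le_ofReal ?_
        rw [div_le_iff₀ hM']
        field_simp
        linarith
    _ = ENNReal.ofReal ε := by
        rw [← ENNReal.ofReal_add (by positivity) (by positivity), add_halves]

/-! ### Perturbation by a smooth process -/

theorem difference_add (X A : ℝ → Ω → ℝ) (k v : ℕ) (δ : ℝ) (i : ℕ) (ω : Ω) :
    difference (fun s ω => X s ω + A s ω) k v δ i ω =
      difference X k v δ i ω + difference A k v δ i ω := by
  simp only [difference, mul_add, Finset.sum_add_distrib]

/-- The pathwise constants come with no measurability in ω. They are replaced by a countable
supremum of normalised differences, which is measurable and finite on every path, so one M serves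
all n. -/
theorem exists_measure_abs_difference_le [IsProbabilityMeasure P] {A : ℝ → Ω → ℝ} {T m : ℝ}
    (hT : 0 < T) (hm : 1 ≤ m) (hA : ∀ t ∈ Icc 0 T, Measurable (A t))
    (hAm : ∀ ω, IsCm m T fun t => A t ω) (k : ℕ) {Δ : ℕ → ℝ} (hΔ : ∀ n, 0 < Δ n) {t : ℝ}
    (ht : t ∈ Icc 0 T) {ε : ℝ} (hε : 0 < ε) :
    ∃ M : ℝ, 1 ≤ M ∧ P {ω | ¬ ∀ n, ∀ i ∈ Finset.Icc k ⌊t / Δ n⌋₊,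
      |difference A k 1 (Δ n) i ω| ≤ M * Δ n ^ min (k : ℝ) m} ≤ ENNReal.ofReal ε := by
  have htimes : ∀ n, ∀ i ∈ Finset.Icc k ⌊t / Δ n⌋₊, (k : ℝ) ≤ i ∧ (i : ℝ) * Δ n ≤ T := by
    intro n i hi
    rw [Finset.mem_Icc] at hi
    refine ⟨by exact_mod_cast hi.1, le_trans ?_ ht.2⟩
    rw [← le_div_iff₀ (hΔ n)]
    exact (Nat.le_floor_iff (div_nonneg ht.1 (hΔ n).le)).1 hi.2
  set N : Ω → ℝ≥0∞ := fun ω => ⨆ n : ℕ, ⨆ i ∈ Finset.Icc k ⌊t / Δ n⌋₊,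
    ENNReal.ofReal (|difference A k 1 (Δ n) i ω| / Δ n ^ min (k : ℝ) m) with hN
  have hNm : Measurable N := by
    refine Measurable.iSup fun n => Measurable.iSup fun i => Measurable.iSup fun hi => ?_
    obtain ⟨hki, hiT⟩ := htimes n i hi
    refine ENNReal.measurable_ofReal.comp (Measurable.div_const (Measurable.abs ?_) _)
    simp_rw [funext fun ω => difference_one_eq A k i (Δ n) ω]
    refine Finset.measurable_fun_sum _ fun j hj => (hA _ ⟨?_, ?_⟩).const_mul _
    · have hj' : (j : ℝ) ≤ k := by
        exact_mod_cast (by simpa [Nat.lt_succ_iff] using hj : j ≤ k)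
      exact mul_nonneg (by linarith) (hΔ n).le
    · have : 0 ≤ (j : ℝ) * Δ n := mul_nonneg j.cast_nonneg (hΔ n).le
      linarith
  have hNfin : ∀ ω, N ω < ∞ := by
    intro ω
    obtain ⟨C, hC⟩ := (hAm ω).exists_abs_fwdDiff_iter_le hT hm k
    refine lt_of_le_of_lt (iSup_le fun n => iSup₂_le fun i hi => ENNReal.ofReal_le_ofReal ?_)
      (ENNReal.ofReal_lt_top (r := C))
    obtain ⟨hki, hiT⟩ := htimes n i hi
    have hpow : 0 < Δ n ^ min (k : ℝ) m := Real.rpow_pos_of_pos (hΔ n) _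
    rw [div_le_iff₀ hpow, difference_one_eq]
    have h1 := sum_choose_eq_fwdDiff_iter (fun t => A t ω) k i (Δ n) 0
    simp only [add_zero] at h1
    rw [h1]
    exact hC _ _ (hΔ n) (mul_nonneg (by linarith) (hΔ n).le) (by linarith)
  obtain ⟨M, hM, hP⟩ := exists_measure_lt_le (P := P) hNm (.of_forall hNfin) hε
  refine ⟨M, hM, (measure_mono fun ω hω => ?_).trans hP⟩
  by_contra hle
  refine hω fun n i hi => ?_
  have hpow : 0 < Δ n ^ min (k : ℝ) m := Real.rpow_pos_of_pos (hΔ n) _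
  rw [← div_le_iff₀ hpow, ← ENNReal.ofReal_le_ofReal_iff (by linarith)]
  refine le_trans ?_ (not_lt.1 hle)
  exact (le_iSup₂ (f := fun i (_ : i ∈ Finset.Icc k ⌊t / Δ n⌋₊) =>
    ENNReal.ofReal (|difference A k 1 (Δ n) i ω| / Δ n ^ min (k : ℝ) m)) i hi).trans
    (le_iSup (fun n : ℕ => ⨆ i ∈ Finset.Icc k ⌊t / Δ n⌋₊,
      ENNReal.ofReal (|difference A k 1 (Δ n) i ω| / Δ n ^ min (k : ℝ) m)) n)

section Perturbation

variable {G X A : ℝ → Ω → ℝ} {p δ t y : ℝ} {ω : Ω}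

theorem abs_normalizedPowerVariation_sub_le (hδ : 0 < δ) (f : ℕ → ℝ)
    (hf : ∀ i ∈ Finset.Icc k ⌊t / δ⌋₊, |(|difference X k 1 δ i ω + difference A k 1 δ i ω| ^ p -
      |difference X k 1 δ i ω| ^ p)| ≤ f i) :
    |normalizedPowerVariation P G (fun s ω => X s ω + A s ω) p k 1 δ t ω -
      normalizedPowerVariation P G X p k 1 δ t ω| ≤
      δ * tau P G k δ ^ (-p) * ∑ i ∈ Finset.Icc k ⌊t / δ⌋₊, f i := by
  have hτ : 0 ≤ tau P G k δ := Real.sqrt_nonneg _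
  simp only [normalizedPowerVariation_one, difference_add]
  rw [← mul_sub, ← Finset.sum_sub_distrib, abs_mul, abs_of_nonneg (by positivity)]
  gcongr
  exact (Finset.abs_sum_le_sum_abs _ _).trans (Finset.sum_le_sum hf)

theorem mul_sum_const_rpow_le (hk : 1 ≤ k) (hδ : 0 < δ) (ht : 0 ≤ t) (hy : 0 ≤ y)
    (hτ : 0 < tau P G k δ) :
    δ * tau P G k δ ^ (-p) * ∑ _i ∈ Finset.Icc k ⌊t / δ⌋₊, y ^ p ≤
      t * (y / tau P G k δ) ^ p := by
  rw [Finset.sum_const, nsmul_eq_mul, Real.div_rpow hy hτ.le, Real.rpow_neg hτ.le]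
  calc δ * (tau P G k δ ^ p)⁻¹ * ((Finset.Icc k ⌊t / δ⌋₊).card * y ^ p)
      ≤ δ * (tau P G k δ ^ p)⁻¹ * (t / δ * y ^ p) := by
        gcongr
        exact card_Icc_floor_le hk (by positivity)
    _ = _ := by field_simp

theorem abs_normalizedPowerVariation_sub_le_of_le_one (hp : 0 < p) (hp1 : p ≤ 1) (hk : 1 ≤ k)
    (hδ : 0 < δ) (ht : 0 ≤ t) (hy : 0 ≤ y) (hτ : 0 < tau P G k δ)
    (hA : ∀ i ∈ Finset.Icc k ⌊t / δ⌋₊, |difference A k 1 δ i ω| ≤ y) :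
    |normalizedPowerVariation P G (fun s ω => X s ω + A s ω) p k 1 δ t ω -
      normalizedPowerVariation P G X p k 1 δ t ω| ≤ t * (y / tau P G k δ) ^ p := by
  refine (abs_normalizedPowerVariation_sub_le hδ (fun _ => y ^ p) fun i hi => ?_).trans
    (mul_sum_const_rpow_le hk hδ ht hy hτ)
  exact (abs_rpow_abs_add_sub_le_of_le_one hp hp1 _ _).trans
    (Real.rpow_le_rpow (abs_nonneg _) (hA i hi) hp.le)

theorem abs_normalizedPowerVariation_sub_le_of_one_lt (hp1 : 1 < p) {C : ℝ} (hC : 0 < C)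
    (hCp : ∀ x z : ℝ, |(|x + z| ^ p - |x| ^ p)| ≤ C * (|z| * |x| ^ (p - 1) + |z| ^ p)) (hk : 1 ≤ k)
    (hδ : 0 < δ) (ht : 0 ≤ t) (hy : 0 ≤ y) (hτ : 0 < tau P G k δ)
    (hA : ∀ i ∈ Finset.Icc k ⌊t / δ⌋₊, |difference A k 1 δ i ω| ≤ y) :
    |normalizedPowerVariation P G (fun s ω => X s ω + A s ω) p k 1 δ t ω -
      normalizedPowerVariation P G X p k 1 δ t ω| ≤
      C * (y / tau P G k δ * normalizedPowerVariation P G X (p - 1) k 1 δ t ω +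
        t * (y / tau P G k δ) ^ p) := by
  refine (abs_normalizedPowerVariation_sub_le hδ
    (fun i => C * (y * |difference X k 1 δ i ω| ^ (p - 1) + y ^ p)) fun i hi => ?_).trans ?_
  · refine (hCp _ _).trans ?_
    have := hA i hi
    gcongr
  · have h := mul_sum_const_rpow_le (G := G) (P := P) (p := p) hk hδ ht hy hτ
    -- Splitting off one factor τ⁻¹ turns the cross term into y/τ times the normalised variation of
    -- order p - 1.
    have hpow : tau P G k δ ^ (-p) = tau P G k δ ^ (-(p - 1)) * (tau P G k δ)⁻¹ := by
      rw [← Real.rpow_neg_one, ← Real.rpow_add hτ]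
      congr 1
      ring
    rw [← Finset.mul_sum, Finset.sum_add_distrib, ← Finset.mul_sum, normalizedPowerVariation_one]
    calc δ * tau P G k δ ^ (-p) * (C * (y * ∑ i ∈ Finset.Icc k ⌊t / δ⌋₊,
          |difference X k 1 δ i ω| ^ (p - 1) + ∑ _i ∈ Finset.Icc k ⌊t / δ⌋₊, y ^ p))
        = C * (δ * tau P G k δ ^ (-p) * (y * ∑ i ∈ Finset.Icc k ⌊t / δ⌋₊,
          |difference X k 1 δ i ω| ^ (p - 1)) +
          δ * tau P G k δ ^ (-p) * ∑ _i ∈ Finset.Icc k ⌊t / δ⌋₊, y ^ p) := by ring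
      _ ≤ C * (δ * tau P G k δ ^ (-p) * (y * ∑ i ∈ Finset.Icc k ⌊t / δ⌋₊,
          |difference X k 1 δ i ω| ^ (p - 1)) + t * (y / tau P G k δ) ^ p) := by gcongr
      _ = _ := by
        rw [hpow]
        ring

end Perturbation

end BSS

/-! ### The rate and the conclusion -/

theorem lemma1 {Ω : Type*} [mΩ : MeasurableSpace Ω] (P : Measure Ω) [IsProbabilityMeasure P]
    (𝓕 : Filtration ℝ mΩ) (W : Set ℝ → Ω → ℝ) (hW : BSS.IsWhiteNoise 𝓕 P W)
    (g : ℝ → ℝ) (hg : MemLp g 2 (volume.restrict (Ioi 0)))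
    (σ : ℝ → Ω → ℝ) (hσ : Adapted 𝓕 σ) (hσ_cadlag : ∀ ω, BSS.IsCadlagFun (fun t => σ t ω))
    (hfinite : ∀ t : ℝ, ∀ᵐ ω ∂P,
      ∫⁻ s in Iio t, ENNReal.ofReal (g (t - s) ^ 2 * σ s ω ^ 2) < ∞)
    (X : ℝ → Ω → ℝ) (hX : BSS.IsMovingAverage 𝓕 P W g σ X)
    (G : ℝ → Ω → ℝ) (hG : BSS.IsGaussianCore 𝓕 P W g G)
    (α : ℝ) (hα : α ∈ Ioo (-(1 / 2) : ℝ) 0 ∪ Ioo (0 : ℝ) (1 / 2))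
    (k : ℕ) (hk : 1 ≤ k)
    (hA1 : BSS.AssumptionA1 P g σ α k) (hA2 : BSS.AssumptionA2 (BSS.variogram P G) α k) :
    ∃ L : ℝ → ℝ, BSS.SlowlyVaryingAtZero L ∧
      ∀ (T : ℝ) (_ : 0 < T) (m : ℝ) (_ : 1 ≤ m)
        (A : ℝ → Ω → ℝ) (_ : ∀ t ∈ Icc 0 T, Measurable (A t))
        (_ : ∀ ω, BSS.IsCm m T (fun t => A t ω))
        (p : ℝ) (_ : 0 < p)
        (Δ : ℕ → ℝ) (_ : ∀ n, 0 < Δ n) (_ : Tendsto Δ atTop (𝓝 0)),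
        (∀ t ∈ Icc 0 T,
          BSS.IsBigOP P
            (fun n ω =>
              BSS.normalizedPowerVariation P G (fun s ω => X s ω + A s ω) p k 1 (Δ n) t ω
                - BSS.normalizedPowerVariation P G X p k 1 (Δ n) t ω)
            (fun n => |Δ n ^ (min (k : ℝ) m - α - 1 / 2) * L (Δ n)| ^ min p 1)) ∧
        Tendsto (fun n => |Δ n ^ (min (k : ℝ) m - α - 1 / 2) * L (Δ n)| ^ min p 1)
          atTop (𝓝 0) := by
  have hα2 : α < 1 / 2 := by
    rcases hα with h | h
    · linarith [h.2]
    · exact h.2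
  have hk1 : (1 : ℝ) ≤ k := by exact_mod_cast hk
  obtain ⟨L₀, hL₀, hgL₀⟩ := hA1.regular
  obtain ⟨L₁, hL₁, hL₁pos, hL₁eq⟩ := hL₀.exists_pos
  have hgL₁ : ∀ᶠ x in 𝓝[>] (0 : ℝ), |g x| = x ^ α * L₁ x := by
    filter_upwards [hL₁eq, self_mem_nhdsWithin] with x hx hx0
    rw [hgL₀ x hx0, abs_mul, abs_of_pos (Real.rpow_pos_of_pos hx0 α), hx]
  obtain ⟨c, hc, hτ⟩ := BSS.exists_le_tau hW hA1.contDiffOn.continuousOn hg hG k hL₁ hL₁pos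
    hgL₁ hα2
  have hL : BSS.SlowlyVaryingAtZero fun x => (L₁ x)⁻¹ := hL₁.inv hL₁pos
  have hLpos : ∀ x, 0 < x → 0 < (L₁ x)⁻¹ := fun x hx => inv_pos.2 (hL₁pos x hx)
  refine ⟨fun x => (L₁ x)⁻¹, hL, fun T hT m hm A hA hAm p hp Δ hΔ hΔ0 => ?_⟩
  have hΔ' : Tendsto Δ atTop (𝓝[>] 0) := tendsto_nhdsWithin_iff.2 ⟨hΔ0, .of_forall hΔ⟩
  set κ := min (k : ℝ) m
  have hκ : 1 ≤ κ := le_min hk1 hm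
  -- Used with e = κ for the rate itself and with e = k to get Δ^k ≤ τ, which the tightness bound
  -- requires.
  have hrlim : ∀ e : ℝ, 1 ≤ e →
      Tendsto (fun n => Δ n ^ (e - α - 1 / 2) * (L₁ (Δ n))⁻¹) atTop (𝓝 0) := fun e he =>
    (hL.tendsto_rpow_mul hLpos (by linarith)).comp hΔ'
  set r : ℕ → ℝ := fun n => Δ n ^ (κ - α - 1 / 2) * (L₁ (Δ n))⁻¹
  have hrpos : ∀ n, 0 < r n := fun n =>
    mul_pos (Real.rpow_pos_of_pos (hΔ n) _) (hLpos _ (hΔ n))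
  have hτn := hΔ'.eventually hτ
  have hτpos : ∀ᶠ n in atTop, 0 < BSS.tau P G k (Δ n) := by
    filter_upwards [hτn] with n hn
    exact lt_of_lt_of_le (mul_pos hc (mul_pos (Real.rpow_pos_of_pos (hΔ n) _) (hL₁pos _ (hΔ n)))) hn
  have hratio : ∀ e : ℝ, ∀ᶠ n in atTop,
      Δ n ^ e / BSS.tau P G k (Δ n) ≤ Δ n ^ (e - α - 1 / 2) * (L₁ (Δ n))⁻¹ / c := by
    intro e
    filter_upwards [hτn] with n hn
    have h1 : 0 < Δ n ^ (α + 1 / 2) := Real.rpow_pos_of_pos (hΔ n) _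
    have h2 := hL₁pos _ (hΔ n)
    calc Δ n ^ e / BSS.tau P G k (Δ n)
        ≤ Δ n ^ e / (c * (Δ n ^ (α + 1 / 2) * L₁ (Δ n))) := by
          have := Real.rpow_pos_of_pos (hΔ n) e
          gcongr
      _ = _ := by
          rw [show e - α - 1 / 2 = e - (α + 1 / 2) by ring, Real.rpow_sub (hΔ n)]
          field_simp
  have hτk : ∀ᶠ n in atTop, Δ n ^ k ≤ BSS.tau P G k (Δ n) := by
    filter_upwards [hratio k, hτpos, (hrlim k hk1).eventually (gt_mem_nhds hc)] with n h1 h2 h3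
    have h4 : Δ n ^ (k : ℝ) / BSS.tau P G k (Δ n) ≤ 1 :=
      h1.trans ((div_le_one hc).2 h3.le)
    rwa [div_le_one h2, Real.rpow_natCast] at h4
  have hrabs : ∀ n, |Δ n ^ (κ - α - 1 / 2) * (L₁ (Δ n))⁻¹| = r n := fun n =>
    abs_of_pos (hrpos n)
  have hmin : 0 < min p 1 := lt_min hp one_pos
  simp only [hrabs]
  refine ⟨fun t ht => ?_, ?_⟩
  · rcases le_or_gt p 1 with hp1 | hp1
    · rw [min_eq_left hp1]
      intro ε hε
      obtain ⟨M, hM, hPM⟩ := BSS.exists_measure_abs_difference_le (P := P) hT hm hA hAm k hΔ ht hε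
      have hM0 : 0 < M := by linarith
      have ht0 := ht.1
      -- The summand 1 only ensures positivity when t = 0.
      refine ⟨t * (M / c) ^ p + 1, by positivity, ?_⟩
      filter_upwards [hτpos, hratio κ] with n hn hrn
      refine (measure_mono fun ω hω hgood => ?_).trans hPM
      have h1 := BSS.abs_normalizedPowerVariation_sub_le_of_le_one (X := X) hp hp1 hk (hΔ n) ht0
        (mul_nonneg hM0.le (Real.rpow_nonneg (hΔ n).le _)) hn (hgood n)
      refine absurd hω (not_lt.2 (h1.trans ?_))
      have hr := hrpos n
      calc t * (M * Δ n ^ κ / BSS.tau P G k (Δ n)) ^ p ≤ t * (M / c * r n) ^ p := by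
            have : 0 ≤ Δ n ^ κ := Real.rpow_nonneg (hΔ n).le _
            rw [mul_div_assoc, div_mul_eq_mul_div, mul_div_assoc]
            gcongr
        _ = t * (M / c) ^ p * r n ^ p := by
            rw [Real.mul_rpow (by positivity) hr.le, mul_assoc]
        _ ≤ _ := by gcongr; linarith
    · rw [min_eq_right hp1.le]
      intro ε hε
      obtain ⟨C, hC, hCp⟩ := BSS.abs_rpow_abs_add_sub_le_of_one_lt hp1
      obtain ⟨M, hM, hPM⟩ := BSS.exists_measure_abs_difference_le (P := P) hT hm hA hAm k hΔ ht
        (half_pos hε)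
      obtain ⟨M', hM', hV⟩ := BSS.isBigOP_normalizedPowerVariation hW hg hA1.contDiffOn
        hA1.antitone_deriv (fun t => (hσ t).mono (𝓕.le t) le_rfl) hσ_cadlag hfinite hX hG hk hΔ
        hτk ht.1 (sub_pos.2 hp1) (ε / 2) (half_pos hε)
      have hM0 : 0 < M := by linarith
      have ht0 := ht.1
      refine ⟨C * (M / c * M' + t * (M / c) ^ p) + 1, by positivity, ?_⟩
      filter_upwards [hτpos, hratio κ, hV, (hrlim κ hκ).eventually (gt_mem_nhds one_pos)]
        with n hn hrn hVn hr1
      have hbound := (measure_union_le _ _).trans (add_le_add hPM hVn)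
      rw [← ENNReal.ofReal_add (by positivity) (by positivity), add_halves] at hbound
      refine (measure_mono fun ω hω => ?_).trans hbound
      by_contra hcon
      rw [mem_union, not_or] at hcon
      have hgood := not_not.1 hcon.1
      have hVω : BSS.normalizedPowerVariation P G X (p - 1) k 1 (Δ n) t ω ≤ M' := by
        have h : ¬ M' * 1 < |BSS.normalizedPowerVariation P G X (p - 1) k 1 (Δ n) t ω| := hcon.2
        rw [mul_one, not_lt] at h
        exact (le_abs_self _).trans h
      have h1 := BSS.abs_normalizedPowerVariation_sub_le_of_one_lt (X := X) hp1 hC hCp hk (hΔ n)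
        ht0 (mul_nonneg hM0.le (Real.rpow_nonneg (hΔ n).le _)) hn (hgood n)
      refine absurd hω (not_lt.2 (h1.trans ?_))
      have hr := hrpos n
      have hu : M * Δ n ^ κ / BSS.tau P G k (Δ n) ≤ M / c * r n := by
        rw [mul_div_assoc, div_mul_eq_mul_div, mul_div_assoc]
        gcongr
      have hu0 : 0 ≤ M * Δ n ^ κ / BSS.tau P G k (Δ n) :=
        div_nonneg (mul_nonneg hM0.le (Real.rpow_nonneg (hΔ n).le _)) hn.le
      -- Eventually r < 1, so the pure power term is absorbed by the linear one.
      have hrp : r n ^ p ≤ r n := by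
        simpa using Real.rpow_le_rpow_of_exponent_ge hr (le_of_lt hr1) hp1.le
      rw [Real.rpow_one]
      calc C * (M * Δ n ^ κ / BSS.tau P G k (Δ n) *
              BSS.normalizedPowerVariation P G X (p - 1) k 1 (Δ n) t ω +
              t * (M * Δ n ^ κ / BSS.tau P G k (Δ n)) ^ p)
          ≤ C * (M * Δ n ^ κ / BSS.tau P G k (Δ n) * M' + t * (M / c * r n) ^ p) := by
            gcongr
        _ ≤ C * (M / c * r n * M' + t * ((M / c) ^ p * r n)) := by
            rw [Real.mul_rpow (by positivity) hr.le]
            gcongr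
        _ = C * (M / c * M' + t * (M / c) ^ p) * r n := by ring
        _ ≤ _ := by gcongr; linarith
  · have := (hrlim κ hκ).rpow_const (p := min p 1) (Or.inr hmin.le)
    rwa [Real.zero_rpow hmin.ne'] at this
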